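/- Let $k$ be a field of characteristic $0$, $V$ a finite-dimensional $k$-vector space, $V^\vee=V^*$ its dual, $\operatorname{ev}:V\otimes V^\vee\to k$ the evaluation and $\operatorname{coev}:k\to V^\vee\otimes V$, $1\mapsto\sum_i v^i\otimes v_i$ (dual bases). For a linear map $T:A\otimes B\to B\otimes A$ of finite-dimensional spaces let $T^\sharp:B\otimes A^*\to A^*\otimes B$ be the map characterised by $(\operatorname{ev}\otimes1)(1\otimes T^\sharp)=(1\otimes\operatorname{ev})(T\otimes1)$ on $A\otimes B\otimes A^*$. Let $R:V\otimes V\to V\otimes V$ be a Hecke $\check R$-matrix with parameter $q$: $q\in k^\times$, $q^2\neq-1$, $R$ and $R^\sharp$ are invertible, $(R\otimes1)(1\otimes R)(R\otimes1)=(1\otimes R)(R\otimes1)(1\otimes R)$, and $(R-q)(R+q^{-1})=0$. Write $c$ for the braidings $c_{V,V}=R$, $c_{V^\vee,V}=(R^\sharp)^{-1}$, $c_{V^\vee,V^\vee}=R^{\sharp\sharp}$; put $$\dim_8V=\operatorname{ev}\circ c_{V^\vee,V}\circ\operatorname{coev}\in k,$$ and for $z\in\mathbb Z$ let $[z]_q$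 be the Laurent polynomial $(q^z-q^{-z})/(q-q^{-1})$ in $q$, so that $[z]_q=q^{z-1}+q^{z-3}+\dots+q^{1-z}$ for $z\ge0$ and $[-z]_q=-[z]_q$. The Koszul complex $K(V)=\bigoplus_{n,m\ge0}K^{n,m}(V)$ is the quotient of the tensor algebra $T(V\oplus V^\vee)$ by the relations $$R(v\otimes\bar v)=-q^{-1}v\otimes\bar v,\qquad R^\sharp(v\otimes v')=q\,v\otimes v',\qquad R^{\sharp\sharp}(v'\otimes\bar v')=q\,v'\otimes\bar v'\qquad(v,\bar v\in V,\ v',\bar v'\in V^\vee),$$ where $K^{n,m}(V)$ is spanned by the products of $n$ elements of $V$ and $m$ elements of $V^\vee$. The differential $D$, of degree $(1,1)$, is left multiplication by $\sum_iv^iv_i\in K^{1,1}(V)$. The differential $D'$, of degree $(-1,-1)$, is the linear map $K(V)\to K(V)$ whose value on the image in $K^{n,m}(V)$ of an element of $T^m(V^\vee)\otimes T^n(V)$ is the image of $$\sum_{k=1}^m\sum_{l=1}^n(-1)^{l-1}q^{k+l-n-1}P_{k,l}$$ applied to that element. Here $P_{k,l}:T^m(V^\vee)\otimes T^n(V)\to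 T^{m-1}(V^\vee)\otimes T^{n-1}(V)$ moves the $k$-th factor $V^\vee$ to the right past the factors $k+1,\dots,m$ by means of $c_{V^\vee,V^\vee}^{-1}$, moves the $l$-th factor $V$ to the left past the factors $l-1,\dots,1$ by means of $c_{V,V}^{-1}$, and then contracts these two, now adjacent, factors by $\operatorname{ev}\circ c_{V^\vee,V}:V^\vee\otimes V\to k$. **Theorem.** Such a linear map $D'$ exists and is unique. For all $n,m\ge0$ the Laplacian $L=D'D+DD'$ acts on $K^{n,m}(V)$ as multiplication by the scalar $$q^{n-m}\dim_8V+[m-n]_q .$$ In particular, if the component $H^{n,m}(K(V),D)$ of the Berezinian $\operatorname{Ber}V=H^*(K(V),D)$ in bidegree $(n,m)$ is non-zero, then $\dim_8V=q^{m-n}[n-m]_q$. -/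

import Mathlib

open scoped TensorProduct
open Module (Dual)

noncomputable section

namespace HeckeKoszul

universe u v

section Sharp

variable {k : Type*} [Field k] {A B : Type*} [AddCommGroup A] [Module k A] [Module.Finite k A]
  [AddCommGroup B] [Module k B]

/-- The canonical isomorphism `A* ⊗ B ≃ Hom(A, B)`, `φ ⊗ b ↦ (a ↦ φ(a) b)`. -/
def dualTensorEquivHom (k : Type*) [Field k] (A B : Type*) [AddCommGroup A] [Module k A]
    [Module.Finite k A] [AddCommGroup B] [Module k B] : Dual k A ⊗[k] B ≃ₗ[k] (A →ₗ[k] B) :=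
  LinearEquiv.ofBijective (dualTensorHom k A B) dualTensorHom_bijective

/-- `1 ⊗ φ : B ⊗ A → B` for a functional `φ` on `A`. -/
def evalRight (B : Type*) [AddCommGroup B] [Module k B] (φ : Dual k A) : B ⊗[k] A →ₗ[k] B :=
  (TensorProduct.rid k B).toLinearMap ∘ₗ φ.lTensor B

/-- For `T : A ⊗ B → B ⊗ A`, the map `T♯ : B ⊗ A* → A* ⊗ B` which sends `b ⊗ φ` to
`∑ₖ aᵏ ⊗ (1 ⊗ φ)(T (aₖ ⊗ b))`, where `aₖ` is any basis of `A` and `aᵏ` is the dual basis. -/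
def sharp (T : A ⊗[k] B →ₗ[k] B ⊗[k] A) : B ⊗[k] Dual k A →ₗ[k] Dual k A ⊗[k] B :=
  (dualTensorEquivHom k A B).symm.toLinearMap ∘ₗ
    TensorProduct.lift (LinearMap.mk₂ k
      (fun (b : B) (φ : Dual k A) =>
        evalRight B φ ∘ₗ T ∘ₗ (TensorProduct.mk k A B).flip b)
      (fun _ _ _ => by ext; simp)
      (fun _ _ _ => by ext; simp)
      (fun _ _ _ => by ext; simp [evalRight, LinearMap.lTensor_add])
      (fun _ _ _ => by ext; simp [evalRight, LinearMap.lTensor_smul]))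

theorem dualTensorHom_sharp (T : A ⊗[k] B →ₗ[k] B ⊗[k] A) (b : B) (φ : Dual k A) (a : A) :
    dualTensorHom k A B (sharp T (b ⊗ₜ φ)) a = evalRight B φ (T (a ⊗ₜ b)) := by
  have h := (dualTensorEquivHom k A B).apply_symm_apply
    (evalRight B φ ∘ₗ T ∘ₗ (TensorProduct.mk k A B).flip b)
  exact congrArg (fun f => f a) h

end Sharp

section Transpose

variable {k : Type*} [Field k] {V : Type*} [AddCommGroup V] [Module k V] [FiniteDimensional k V]

/-- `R♯♯` is the transpose of `R` for the pairing `⟨x ⊗ y, ξ ⊗ η⟩ = η(x) ξ(y)`. -/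
theorem pairing_sharp_sharp (R : V ⊗[k] V →ₗ[k] V ⊗[k] V)
    (w : Dual k V ⊗[k] Dual k V) (z : V ⊗[k] V) :
    TensorProduct.dualDistrib k V V (TensorProduct.comm k _ _ (sharp (sharp R) w)) z
      = TensorProduct.dualDistrib k V V (TensorProduct.comm k _ _ w) (R z) := by
  have h1 : ∀ (s : Dual k V ⊗[k] Dual k V) (x y : V),
      TensorProduct.dualDistrib k V V (TensorProduct.comm k _ _ s) (x ⊗ₜ y)
        = dualTensorHom k V (Dual k V) s y x := by
    intro s x y
    induction s using TensorProduct.induction_on with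
    | zero => simp
    | tmul a b => simp [mul_comm]
    | add a b ha hb => simp only [map_add, LinearMap.add_apply, ha, hb]
  have h2 : ∀ (t : Dual k V ⊗[k] V) (η : Dual k V) (x : V),
      evalRight (Dual k V) η t x = η (dualTensorHom k V V t x) := by
    intro t η x
    induction t using TensorProduct.induction_on with
    | zero => simp
    | tmul a b => simp [evalRight, mul_comm]
    | add a b ha hb => simp only [map_add, LinearMap.add_apply, ha, hb]
  have h3 : ∀ (z : V ⊗[k] V) (ξ η : Dual k V),
      η (evalRight V ξ z) = TensorProduct.dualDistrib k V V (η ⊗ₜ ξ) z := by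
    intro z ξ η
    induction z using TensorProduct.induction_on with
    | zero => simp
    | tmul a b => simp [evalRight, mul_comm]
    | add a b ha hb => simp only [map_add, ha, hb]
  induction z using TensorProduct.induction_on with
  | zero => simp
  | add a b ha hb => simp only [map_add, ha, hb]
  | tmul x y =>
    induction w using TensorProduct.induction_on with
    | zero => simp
    | add a b ha hb => simp only [map_add, LinearMap.add_apply, ha, hb]
    | tmul ξ η =>
      rw [h1, dualTensorHom_sharp, h2, dualTensorHom_sharp, h3, TensorProduct.comm_tmul]

theorem sharp_sharp_bijective {R : V ⊗[k] V →ₗ[k] V ⊗[k] V} (hR : Function.Bijective R) :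
    Function.Bijective (sharp (sharp R)) := by
  have hinj : Function.Injective (sharp (sharp R)) := by
    refine (injective_iff_map_eq_zero _).2 fun w hw => ?_
    have h0 : TensorProduct.dualDistrib k V V (TensorProduct.comm k _ _ w) = 0 := by
      ext1
      ext x y
      obtain ⟨z, hz⟩ := hR.2 (x ⊗ₜ y)
      have h := pairing_sharp_sharp R w z
      rw [hw, hz] at h
      simpa using h.symm
    have h1 : TensorProduct.comm k _ _ w = 0 :=
      (TensorProduct.dualDistribEquiv k V V).injective (h0.trans (map_zero _).symm)
    simpa using h1
  exact ⟨hinj, LinearMap.surjective_of_injective (K := k) (V := Dual k V ⊗[k] Dual k V) hinj⟩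

end Transpose

/-- The `q`-integer `[z]_q = (q^z - q^{-z}) / (q - q⁻¹)`, `z ∈ ℤ`, written as the Laurent
polynomial `q^{z-1} + q^{z-3} + ⋯ + q^{1-z}` for `z ≥ 0` and as `-[-z]_q` for `z < 0`
(so that it also makes sense for `q = ±1`). -/
def qInt {k : Type*} [Field k] (q : k) : ℤ → k
  | Int.ofNat n => ∑ i ∈ Finset.range n, q ^ ((n : ℤ) - 1 - 2 * (i : ℤ))
  | Int.negSucc n => -∑ i ∈ Finset.range (n + 1), q ^ ((n : ℤ) - 2 * (i : ℤ))

variable {k : Type u} [Field k] {V : Type v} [AddCommGroup V] [Module k V]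
  [FiniteDimensional k V]

/-- `R : V ⊗ V → V ⊗ V` is a Hecke Ř-matrix with parameter `q`. -/
structure IsHecke (q : k) (R : V ⊗[k] V →ₗ[k] V ⊗[k] V) : Prop where
  q_ne_zero : q ≠ 0
  q_sq_ne : q ^ 2 ≠ -1
  bijective : Function.Bijective R
  /-- `(R ⊗ 1)(1 ⊗ R)(R ⊗ 1) = (1 ⊗ R)(R ⊗ 1)(1 ⊗ R)` on `V ⊗ (V ⊗ V)` -/
  braid :
    let R₁₂ : V ⊗[k] (V ⊗[k] V) →ₗ[k] V ⊗[k] (V ⊗[k] V) :=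
      (TensorProduct.assoc k V V V).toLinearMap ∘ₗ R.rTensor V ∘ₗ
        (TensorProduct.assoc k V V V).symm.toLinearMap
    let R₂₃ : V ⊗[k] (V ⊗[k] V) →ₗ[k] V ⊗[k] (V ⊗[k] V) := R.lTensor V
    R₁₂ ∘ₗ R₂₃ ∘ₗ R₁₂ = R₂₃ ∘ₗ R₁₂ ∘ₗ R₂₃
  /-- `(R - q)(R + q⁻¹) = 0` -/
  quadratic : (R - q • LinearMap.id) ∘ₗ (R + q⁻¹ • LinearMap.id) = 0
  sharp_bijective : Function.Bijective (sharp R)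

section Crossings

variable {q : k} {R : V ⊗[k] V →ₗ[k] V ⊗[k] V}

/-- `c⁻¹ : V ⊗ V → V ⊗ V`, where `c = R`. -/
def braidInvVV (hR : IsHecke q R) : V ⊗[k] V →ₗ[k] V ⊗[k] V :=
  (LinearEquiv.ofBijective R hR.bijective).symm.toLinearMap

/-- The braiding `c : V^∨ ⊗ V → V ⊗ V^∨`, that is, `(R♯)⁻¹`. -/
def braidDualV (hR : IsHecke q R) : Dual k V ⊗[k] V →ₗ[k] V ⊗[k] Dual k V :=
  (LinearEquiv.ofBijective (sharp R) hR.sharp_bijective).symm.toLinearMap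

/-- `c⁻¹ : V^∨ ⊗ V^∨ → V^∨ ⊗ V^∨`, where `c = R♯♯`. -/
def braidInvDualDual (hR : IsHecke q R) :
    Dual k V ⊗[k] Dual k V →ₗ[k] Dual k V ⊗[k] Dual k V :=
  (LinearEquiv.ofBijective (sharp (sharp R)) (sharp_sharp_bijective hR.bijective)).symm.toLinearMap

variable (k V) in
/-- `coev(1) = ∑ᵢ vⁱ ⊗ vᵢ ∈ V^∨ ⊗ V`. -/
def coevOne : Dual k V ⊗[k] V :=
  (dualTensorEquivHom k V V).symm LinearMap.id

/-- The 8-dimension `k --coev--> V^∨ ⊗ V --c--> V ⊗ V^∨ --ev--> k`. -/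
def dim8 (hR : IsHecke q R) : k :=
  contractRight k V (braidDualV hR (coevOne k V))

end Crossings

section Algebra

variable (q : k) (R : V ⊗[k] V →ₗ[k] V ⊗[k] V)

/-- The linear map `X ⊗ Y → A`, `x ⊗ y ↦ f(x) g(y)`, to an algebra `A`. -/
def mulMap {X Y A : Type*} [AddCommGroup X] [Module k X] [AddCommGroup Y] [Module k Y]
    [Ring A] [Algebra k A] (f : X →ₗ[k] A) (g : Y →ₗ[k] A) : X ⊗[k] Y →ₗ[k] A :=
  LinearMap.mul' k A ∘ₗ TensorProduct.map f g

variable (k V) in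
/-- The inclusion of `V` in the tensor algebra `T(V ⊕ V^∨)`. -/
def tV : V →ₗ[k] TensorAlgebra k (V × Dual k V) :=
  TensorAlgebra.ι k ∘ₗ LinearMap.inl k V (Dual k V)

variable (k V) in
/-- The inclusion of `V^∨` in the tensor algebra `T(V ⊕ V^∨)`. -/
def tDual : Dual k V →ₗ[k] TensorAlgebra k (V × Dual k V) :=
  TensorAlgebra.ι k ∘ₗ LinearMap.inr k V (Dual k V)

/-- The defining relations of the Koszul complex. -/
inductive KoszulRel :
    TensorAlgebra k (V × Dual k V) → TensorAlgebra k (V × Dual k V) → Prop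
  | exterior (v w : V) :
      KoszulRel (mulMap (tV k V) (tV k V) (R (v ⊗ₜ w))) (-q⁻¹ • (tV k V v * tV k V w))
  | mixed (v : V) (ξ : Dual k V) :
      KoszulRel (mulMap (tDual k V) (tV k V) (sharp R (v ⊗ₜ ξ))) (q • (tV k V v * tDual k V ξ))
  | symmetric (ξ η : Dual k V) :
      KoszulRel (mulMap (tDual k V) (tDual k V) (sharp (sharp R) (ξ ⊗ₜ η)))
        (q • (tDual k V ξ * tDual k V η))

/-- The algebra `K(V)`. -/
def KoszulAlgebra : Type (max u v) := RingQuot (KoszulRel q R)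

instance : Ring (KoszulAlgebra q R) := inferInstanceAs (Ring (RingQuot (KoszulRel q R)))

instance : Algebra k (KoszulAlgebra q R) := inferInstanceAs (Algebra k (RingQuot (KoszulRel q R)))

/-- The projection `T(V ⊕ V^∨) → K(V)`. -/
def proj : TensorAlgebra k (V × Dual k V) →ₐ[k] KoszulAlgebra q R :=
  RingQuot.mkAlgHom k (KoszulRel q R)

/-- The canonical map `V → K(V)`. -/
def gV : V →ₗ[k] KoszulAlgebra q R := (proj q R).toLinearMap ∘ₗ tV k V

/-- The canonical map `V^∨ → K(V)`. -/
def gDual : Dual k V →ₗ[k] KoszulAlgebra q R :=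
  (proj q R).toLinearMap ∘ₗ tDual k V

/-- The bigraded component `K^{n,m}(V)`: the image of `T^{n,m}(V ⊕ V^∨)`, that is, the span of the
products of `n` elements of `V` and `m` elements of `V^∨` in any order. -/
def component (n m : ℕ) : Submodule k (KoszulAlgebra q R) :=
  Submodule.span k {x | ∃ w : List (V ⊕ Dual k V),
    w.countP Sum.isLeft = n ∧ w.countP Sum.isRight = m ∧
      x = (w.map (Sum.elim (gV q R) (gDual q R))).prod}

/-- The element `𝐝 = ∑ᵢ vⁱ vᵢ` of `K^{1,1}(V)`. -/
def dElt : KoszulAlgebra q R := mulMap (gDual q R) (gV q R) (coevOne k V)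

/-- The differential `D` of degree `(1,1)`: left multiplication by `𝐝`. -/
def diffD : KoszulAlgebra q R →ₗ[k] KoszulAlgebra q R := LinearMap.mulLeft k (dElt q R)

/-- The cocycles of `D` in bidegree `(n,m)`. -/
def cocycles (n m : ℕ) : Submodule k (KoszulAlgebra q R) :=
  component q R n m ⊓ LinearMap.ker (diffD q R)

/-- The coboundaries of `D` in bidegree `(n,m)`: the image of `K^{n-1,m-1}(V)`, which is zero if
`n = 0` or `m = 0`. -/
def coboundaries : ℕ → ℕ → Submodule k (KoszulAlgebra q R)
  | n + 1, m + 1 => (component q R n m).map (diffD q R)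
  | _, _ => ⊥

/-- The component `H^{n,m}(K(V), D)` of the Berezinian `Ber(V) = H^*(K(V), D)`. -/
abbrev Ber (n m : ℕ) : Type (max u v) :=
  cocycles q R n m ⧸ (coboundaries q R n m).comap (cocycles q R n m).subtype

end Algebra

section Sweep

variable {W X A : Type*} [AddCommGroup W] [Module k W] [AddCommGroup X] [Module k X]
  [Ring A] [Algebra k A]

/-- A strand `w` is moved from the left to the right of `x₁ ⋯ xⱼ` by means of the crossing
`C : W ⊗ X → X ⊗ W`, and the other strands are multiplied in `A` in the order in which they then
stand. The result is in `A ⊗ W`. -/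
def moveRight (C : W ⊗[k] X →ₗ[k] X ⊗[k] W) (g : X →ₗ[k] A) : List X → (W →ₗ[k] A ⊗[k] W)
  | [] => TensorProduct.mk k A W 1
  | x :: xs =>
      (LinearMap.mul' k A).rTensor W ∘ₗ (TensorProduct.assoc k A A W).symm.toLinearMap ∘ₗ
        TensorProduct.map g (moveRight C g xs) ∘ₗ C ∘ₗ (TensorProduct.mk k W X).flip x

/-- A strand `w` is moved from the right to the left of `x₁ ⋯ xⱼ` by means of the crossing
`C : X ⊗ W → W ⊗ X`, and the other strands are multiplied in `A` in the order in which they then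
stand. The result is in `W ⊗ A`. -/
def moveLeft (C : X ⊗[k] W →ₗ[k] W ⊗[k] X) (g : X →ₗ[k] A) : List X → (W →ₗ[k] W ⊗[k] A)
  | [] => (TensorProduct.mk k W A).flip 1
  | x :: xs =>
      (LinearMap.mul' k A).lTensor W ∘ₗ (TensorProduct.assoc k W A A).toLinearMap ∘ₗ
        (g.lTensor W).rTensor A ∘ₗ C.rTensor A ∘ₗ (TensorProduct.assoc k X W A).symm.toLinearMap ∘ₗ
          TensorProduct.mk k X (W ⊗[k] A) x ∘ₗ moveLeft C g xs

end Sweep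

section DPrime

variable {q : k} {R : V ⊗[k] V →ₗ[k] V ⊗[k] V}

/-- The map `(a ⊗ ξ) ⊗ (v ⊗ b) ↦ a · ev(c(ξ ⊗ v)) · b`. -/
def contractMiddle (hR : IsHecke q R) :
    (KoszulAlgebra q R ⊗[k] Dual k V) ⊗[k] (V ⊗[k] KoszulAlgebra q R) →ₗ[k] KoszulAlgebra q R :=
  LinearMap.mul' k (KoszulAlgebra q R) ∘ₗ
    ((TensorProduct.lid k (KoszulAlgebra q R)).toLinearMap ∘ₗ
      (contractRight k V ∘ₗ braidDualV hR).rTensor (KoszulAlgebra q R) ∘ₗ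
      (TensorProduct.assoc k (Dual k V) V (KoszulAlgebra q R)).symm.toLinearMap).lTensor
        (KoszulAlgebra q R) ∘ₗ
    (TensorProduct.assoc k (KoszulAlgebra q R) (Dual k V)
      (V ⊗[k] KoszulAlgebra q R)).toLinearMap

/-- One summand of `D'` (without its coefficient) on the word `ξ₁ ⋯ ξₘ v₁ ⋯ vₙ`, with `i = k - 1`
and `j = l - 1`: the strand `ξₖ` is moved to the right over `ξₖ₊₁, …, ξₘ`, the strand `vₗ` is moved
to the left under `v₁, …, vₗ₋₁`, and then the two are contracted by
`V^∨ ⊗ V --c--> V ⊗ V^∨ --ev--> k`. -/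
def dPrimeTerm (hR : IsHecke q R) (ξ : List (Dual k V)) (v : List V)
    (i : Fin ξ.length) (j : Fin v.length) : KoszulAlgebra q R :=
  ((ξ.take i).map (gDual q R)).prod *
    contractMiddle hR
      (moveRight (braidInvDualDual hR) (gDual q R) (ξ.drop (i + 1)) (ξ.get i) ⊗ₜ
        moveLeft (braidInvVV hR) (gV q R) (v.take j) (v.get j)) *
    ((v.drop (j + 1)).map (gV q R)).prod

/-- `D'` is the differential of degree `(-1,-1)`: on `T^m(V^∨) ⊗ T^n(V)` it is given by
`∑_{k=1}^m ∑_{l=1}^n (-1)^{l-1} q^{k+l-n-1}` times the summand described above. -/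
def IsDiffDPrime (hR : IsHecke q R) (D' : KoszulAlgebra q R →ₗ[k] KoszulAlgebra q R) : Prop :=
  ∀ (ξ : List (Dual k V)) (v : List V),
    D' ((ξ.map (gDual q R)).prod * (v.map (gV q R)).prod) =
      ∑ i : Fin ξ.length, ∑ j : Fin v.length,
        ((-1) ^ (j : ℕ) * q ^ ((i : ℤ) + (j : ℤ) + 1 - (v.length : ℤ))) •
          dPrimeTerm hR ξ v i j

end DPrime

end HeckeKoszul

end

/-! The differential `D'` is a second-order operator built from two braided partial derivatives.
`derivDual` maps `K(V)` to `V^∨ ⊗ K(V)` by extracting one factor of `V^∨`, `derivV` maps `K(V)` to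
`V ⊗ K(V)` by extracting one factor of `V`, and `dPrime` contracts the two extracted strands by `ev
∘ c`.

These derivatives exist by the universal property of `K(V)`: a twisted derivation `K → W ⊗ K` is the
corner of a representation by upper triangular operators on `K × (W ⊗ K)`. On the diagonal the
defining relations follow from the relations of `K(V)` and from braid relations, which pass from `R`
to `R♯` and `R♯♯` by `sharp_braid` and can be partially inverted. In the corner they amount to the
quadratic relation, or to `R♯` being inverse to `c`. A strand can be pulled across the cap `ev ∘ c`
(`contr_evBraid_dual`, `contr_evBraid_V`). This yields the recursions `dPrime_gDual_mul` and
`dPrime_gV_mul`, and unrolling them gives the double sum over `k` and `l`. Uniqueness holds because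
the words with all factors of `V^∨` in front span `K(V)`.

For the Laplacian, `D'` is applied to `∑ vⁱ vᵢ x`. The second-order term is `-D D' x`, which cancels
in `L`. If both strands of `coev` are contracted with each other, a multiple of `dim8` results. If
only one of them is contracted with `x`, the result is an Euler operator (multiply an extracted
factor back on the left), which acts on `K^{n,m}` by a `q`-integer (`leftMul_derivV`,
`leftMul_derivDual`). In the term in which `x` loses a factor of `V`, that factor first crosses
`coev` by `R⁻¹ = R - (q - q⁻¹)`, which produces the coefficient `1 - (q - q⁻¹) dim8`
(`contr_coevOne`). The three scalars add up by `laplacian_scalar`.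

If the scalar is non-zero, `D'` divided by it contracts `D` in that bidegree, so the cohomology
there vanishes. -/

noncomputable section

namespace HeckeKoszul

/-! ### Dualizing a strand of the braid relation -/

section Braid

variable {k : Type*} [Field k] {A A' B B' C W X Y : Type*}
  [AddCommGroup A] [Module k A] [AddCommGroup A'] [Module k A'] [AddCommGroup B] [Module k B]
  [AddCommGroup B'] [Module k B'] [AddCommGroup C] [Module k C] [AddCommGroup W] [Module k W]
  [AddCommGroup X] [Module k X] [AddCommGroup Y] [Module k Y]

/-- The map `T ⊗ 1` on a right-associated triple tensor product. -/
def onFirst (T : A ⊗[k] B →ₗ[k] A' ⊗[k] B') (C : Type*) [AddCommGroup C] [Module k C] :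
    A ⊗[k] (B ⊗[k] C) →ₗ[k] A' ⊗[k] (B' ⊗[k] C) :=
  (TensorProduct.assoc k A' B' C).toLinearMap ∘ₗ T.rTensor C ∘ₗ
    (TensorProduct.assoc k A B C).symm.toLinearMap

@[simp]
theorem onFirst_tmul (T : A ⊗[k] B →ₗ[k] A' ⊗[k] B') (a : A) (b : B) (c : C) :
    onFirst T C (a ⊗ₜ (b ⊗ₜ c)) = TensorProduct.assoc k A' B' C (T (a ⊗ₜ b) ⊗ₜ c) := by
  simp [onFirst]

theorem onFirst_assoc (T : A ⊗[k] B →ₗ[k] A' ⊗[k] B') (z : A ⊗[k] B) (c : C) :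
    onFirst T C (TensorProduct.assoc k A B C (z ⊗ₜ c))
      = TensorProduct.assoc k A' B' C (T z ⊗ₜ c) := by
  simp [onFirst]

theorem onFirst_comp {A'' B'' : Type*} [AddCommGroup A''] [Module k A''] [AddCommGroup B'']
    [Module k B''] (S : A' ⊗[k] B' →ₗ[k] A'' ⊗[k] B'') (T : A ⊗[k] B →ₗ[k] A' ⊗[k] B') :
    onFirst S C ∘ₗ onFirst T C = onFirst (S ∘ₗ T) C := by
  ext a b c
  simp [onFirst_assoc]

theorem onFirst_id : onFirst (LinearMap.id : A ⊗[k] B →ₗ[k] A ⊗[k] B) C = LinearMap.id := by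
  ext a b c
  simp

theorem dualTensorHom_assoc (t : Dual k A ⊗[k] B) (x : X) (a : A) :
    dualTensorHom k A (B ⊗[k] X) (TensorProduct.assoc k _ _ _ (t ⊗ₜ x)) a
      = dualTensorHom k A B t a ⊗ₜ x := by
  induction t using TensorProduct.induction_on with
  | zero => simp
  | tmul φ b => simp [TensorProduct.smul_tmul']
  | add s t hs ht => simp only [TensorProduct.add_tmul, map_add, LinearMap.add_apply, hs, ht]

theorem lTensor_dualTensorHom_tmul (φ : Dual k A) (x : X) (z : B ⊗[k] A) :
    (dualTensorHom k A X (φ ⊗ₜ x)).lTensor B z = evalRight B φ z ⊗ₜ x := by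
  induction z using TensorProduct.induction_on with
  | zero => simp
  | tmul b a => simp [evalRight, TensorProduct.smul_tmul']
  | add s t hs ht => simp only [TensorProduct.add_tmul, map_add, hs, ht]

theorem dualTensorHom_lTensor (f : B →ₗ[k] X) (t : Dual k A ⊗[k] B) (a : A) :
    dualTensorHom k A X (f.lTensor _ t) a = f (dualTensorHom k A B t a) := by
  induction t using TensorProduct.induction_on with
  | zero => simp
  | tmul φ b => simp
  | add s t hs ht => simp only [map_add, LinearMap.add_apply, hs, ht]

theorem evalRight_tmul (φ : Dual k A) (b : B) (a : A) : evalRight B φ (b ⊗ₜ a) = φ a • b := by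
  simp [evalRight]

theorem map_lTensor_evalRight (T : B ⊗[k] C →ₗ[k] C ⊗[k] B) (φ : Dual k A)
    (y : B ⊗[k] (C ⊗[k] A)) :
    T ((evalRight C φ).lTensor B y) = (evalRight B φ).lTensor C (onFirst T A y) := by
  have h : ∀ (z : C ⊗[k] B) (a : A), (evalRight B φ).lTensor C
      (TensorProduct.assoc k _ _ _ (z ⊗ₜ a)) = φ a • z := by
    intro z a
    induction z using TensorProduct.induction_on with
    | zero => simp
    | tmul c b => simp [evalRight_tmul]
    | add s t hs ht => simp only [TensorProduct.add_tmul, map_add, hs, ht, smul_add]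
  suffices H : T ∘ₗ (evalRight C φ).lTensor B = (evalRight B φ).lTensor C ∘ₗ onFirst T A from
    LinearMap.congr_fun H y
  ext b c a
  simp [h, evalRight_tmul]

variable [Module.Finite k A]

/-- This is the characterisation of `T♯` with a spectator strand `X`: evaluating the dual strand
after the crossing equals crossing by `T` first and evaluating afterwards. -/
theorem dualTensorHom_onFirst_sharp (T : A ⊗[k] B →ₗ[k] B ⊗[k] A) (b : B) (y : Dual k A ⊗[k] X)
    (a : A) :
    dualTensorHom k A (B ⊗[k] X) (onFirst (sharp T) X (b ⊗ₜ y)) a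
      = (dualTensorHom k A X y).lTensor B (T (a ⊗ₜ b)) := by
  induction y using TensorProduct.induction_on with
  | zero => simp
  | tmul φ x =>
    rw [onFirst_tmul, dualTensorHom_assoc, dualTensorHom_sharp, lTensor_dualTensorHom_tmul]
  | add s t hs ht =>
    simp only [TensorProduct.tmul_add, map_add, LinearMap.add_apply, hs, ht, LinearMap.lTensor_add]

theorem lTensor_dualTensorHom_sharp (U : A ⊗[k] C →ₗ[k] C ⊗[k] A) (c : C) (φ : Dual k A)
    (z : B ⊗[k] A) :
    (dualTensorHom k A C (sharp U (c ⊗ₜ φ))).lTensor B z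
      = (evalRight C φ).lTensor B (U.lTensor B (TensorProduct.assoc k _ _ _ (z ⊗ₜ c))) := by
  induction z using TensorProduct.induction_on with
  | zero => simp
  | tmul b a => simp [dualTensorHom_sharp]
  | add s t hs ht => simp only [TensorProduct.add_tmul, map_add, hs, ht]

theorem dualTensor_ext {s t : Dual k A ⊗[k] X}
    (h : ∀ a, dualTensorHom k A X s a = dualTensorHom k A X t a) : s = t :=
  dualTensorHom_bijective.1 (LinearMap.ext h)

/-- Dualizing the first strand of the braid relation on `A ⊗ B ⊗ C`. -/
theorem sharp_braid (T : A ⊗[k] B →ₗ[k] B ⊗[k] A) (U : A ⊗[k] C →ₗ[k] C ⊗[k] A)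
    (S : B ⊗[k] C →ₗ[k] C ⊗[k] B)
    (h : onFirst S A ∘ₗ U.lTensor B ∘ₗ onFirst T C = T.lTensor C ∘ₗ onFirst U B ∘ₗ S.lTensor A) :
    S.lTensor (Dual k A) ∘ₗ onFirst (sharp T) C ∘ₗ (sharp U).lTensor B
      = onFirst (sharp U) B ∘ₗ (sharp T).lTensor C ∘ₗ onFirst S (Dual k A) := by
  ext b c φ : 5
  -- Evaluating the outgoing dual strand at `a` turns every `♯` back into the original crossing.
  -- Both sides become the two sides of `h` at `a ⊗ b ⊗ c`, with the strand `A` contracted by `φ`.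
  refine dualTensor_ext fun a => ?_
  have h1 := LinearMap.congr_fun h (a ⊗ₜ (b ⊗ₜ c))
  have h2 : ∀ z : C ⊗[k] B,
      dualTensorHom k A (C ⊗[k] B) (onFirst (sharp U) B ((sharp T).lTensor C
        (TensorProduct.assoc k _ _ _ (z ⊗ₜ φ)))) a
      = (evalRight B φ).lTensor C (T.lTensor C (onFirst U B (a ⊗ₜ z))) := by
    intro z
    induction z using TensorProduct.induction_on with
    | zero => simp
    | tmul c b =>
      simp only [TensorProduct.assoc_tmul, LinearMap.lTensor_tmul, dualTensorHom_onFirst_sharp,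
        lTensor_dualTensorHom_sharp, onFirst_tmul]
    | add s t hs ht =>
      simp only [TensorProduct.add_tmul, TensorProduct.tmul_add, map_add, LinearMap.add_apply,
        hs, ht]
  simp only [LinearMap.comp_apply, onFirst_tmul, LinearMap.lTensor_tmul] at h1
  simp only [TensorProduct.AlgebraTensorModule.curry_apply, LinearMap.restrictScalars_self,
    TensorProduct.curry_apply, LinearMap.comp_apply, onFirst_tmul, LinearMap.lTensor_tmul, h2,
    dualTensorHom_lTensor, dualTensorHom_onFirst_sharp, lTensor_dualTensorHom_sharp,
    map_lTensor_evalRight, h1]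

end Braid

/-! ### Triangular operators that produce twisted derivations -/

section CrossAct

variable {k : Type*} [Field k] {A W X Y : Type*} [Ring A] [Algebra k A]
  [AddCommGroup W] [Module k W] [AddCommGroup X] [Module k X] [AddCommGroup Y] [Module k Y]

@[simp]
theorem mulMap_tmul (f : X →ₗ[k] A) (g : Y →ₗ[k] A) (x : X) (y : Y) :
    mulMap f g (x ⊗ₜ y) = f x * g y := by
  simp [mulMap]

/-- `x ↦ g(x) a`. -/
def mulConst (g : X →ₗ[k] A) (a : A) : X →ₗ[k] A := LinearMap.mulRight k a ∘ₗ g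

@[simp]
theorem mulConst_apply (g : X →ₗ[k] A) (a : A) (x : X) : mulConst g a x = g x * a := rfl

/-- The operators on `W ⊗ A` by which `x : X` crosses `W` by means of `C` and then multiplies
the elements of `A` by `g x`. -/
def crossAct (C : X ⊗[k] W →ₗ[k] W ⊗[k] X) (g : X →ₗ[k] A) :
    X →ₗ[k] Module.End k (W ⊗[k] A) :=
  (TensorProduct.mk k X (W ⊗[k] A)).compr₂
    ((LinearMap.mul' k A ∘ₗ g.rTensor A).lTensor W ∘ₗ onFirst C A)

theorem crossAct_tmul (C : X ⊗[k] W →ₗ[k] W ⊗[k] X) (g : X →ₗ[k] A) (x : X) (w : W) (a : A) :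
    crossAct C g x (w ⊗ₜ a) = (mulConst g a).lTensor W (C (x ⊗ₜ w)) := by
  have h : ∀ z : W ⊗[k] X, (LinearMap.mul' k A ∘ₗ g.rTensor A).lTensor W
      (TensorProduct.assoc k _ _ _ (z ⊗ₜ a)) = (mulConst g a).lTensor W z := by
    intro z
    induction z using TensorProduct.induction_on with
    | zero => simp
    | tmul w x => simp
    | add s t hs ht => simp only [TensorProduct.add_tmul, map_add, hs, ht]
  simp only [crossAct, LinearMap.compr₂_apply, TensorProduct.mk_apply, LinearMap.comp_apply,
    onFirst_tmul]
  exact h _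

/-- Both strands cross `W` before anything is multiplied. The product then stands to the right of
`W`, where a relation of the algebra can be applied to it. -/
theorem mulMap_crossAct_tmul (C : X ⊗[k] W →ₗ[k] W ⊗[k] X) (g : X →ₗ[k] A)
    (C' : Y ⊗[k] W →ₗ[k] W ⊗[k] Y) (g' : Y →ₗ[k] A) (z : X ⊗[k] Y) (w : W) (a : A) :
    mulMap (crossAct C g) (crossAct C' g') z (w ⊗ₜ a)
      = (mulConst (mulMap g g') a).lTensor W
          (onFirst C Y (C'.lTensor X (TensorProduct.assoc k _ _ _ (z ⊗ₜ w)))) := by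
  have h1 : ∀ (u : W ⊗[k] X) (y : Y), (mulConst g (g' y * a)).lTensor W u
      = (mulConst (mulMap g g') a).lTensor W (TensorProduct.assoc k _ _ _ (u ⊗ₜ y)) := by
    intro u y
    induction u using TensorProduct.induction_on with
    | zero => simp
    | tmul w x => simp [mul_assoc]
    | add s t hs ht => simp only [TensorProduct.add_tmul, map_add, hs, ht]
  have h2 : ∀ (u : W ⊗[k] Y) (x : X), crossAct C g x ((mulConst g' a).lTensor W u)
      = (mulConst (mulMap g g') a).lTensor W (onFirst C Y (x ⊗ₜ u)) := by
    intro u x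
    induction u using TensorProduct.induction_on with
    | zero => simp
    | tmul w y => simp [crossAct_tmul, h1]
    | add s t hs ht => simp only [TensorProduct.tmul_add, map_add, hs, ht]
  induction z using TensorProduct.induction_on with
  | zero => simp
  | tmul x y => simp [crossAct_tmul, h2, Module.End.mul_apply]
  | add s t hs ht => simp only [TensorProduct.add_tmul, map_add, LinearMap.add_apply, hs, ht]

/-- By `hb` the crossing `P` slides past the strand `W` and meets the product in `A`, where `hP`
replaces it by `κ`. Thus quadratic relations in `A` persist for the operators on `W ⊗ A`. -/
theorem mulMap_crossAct_braid (C : X ⊗[k] W →ₗ[k] W ⊗[k] X) (g : X →ₗ[k] A)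
    (C' : Y ⊗[k] W →ₗ[k] W ⊗[k] Y) (g' : Y →ₗ[k] A) (P : X ⊗[k] Y →ₗ[k] Y ⊗[k] X) (κ : k)
    (hP : ∀ z, mulMap g' g (P z) = κ • mulMap g g' z)
    (hb : onFirst C' X ∘ₗ C.lTensor Y ∘ₗ onFirst P W = P.lTensor W ∘ₗ onFirst C Y ∘ₗ C'.lTensor X)
    (z : X ⊗[k] Y) :
    mulMap (crossAct C' g') (crossAct C g) (P z)
      = κ • mulMap (crossAct C g) (crossAct C' g') z := by
  ext w a
  simp only [TensorProduct.AlgebraTensorModule.curry_apply, LinearMap.restrictScalars_self,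
    TensorProduct.curry_apply, LinearMap.smul_apply, mulMap_crossAct_tmul]
  have h1 := LinearMap.congr_fun hb (TensorProduct.assoc k _ _ _ (z ⊗ₜ w))
  simp only [LinearMap.comp_apply, onFirst_assoc] at h1
  have h2 : mulConst (mulMap g' g) a ∘ₗ P = κ • mulConst (mulMap g g') a := by
    ext x y
    simp [hP]
  rw [h1, ← LinearMap.comp_apply, ← LinearMap.lTensor_comp, h2, LinearMap.lTensor_smul,
    LinearMap.smul_apply]

/-- Upper triangular operators on `A × (W ⊗ A)`, from which twisted derivations `A → W ⊗ A` are
obtained. -/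
def triAct (α γ : k) (h : X →ₗ[k] W) (C : X ⊗[k] W →ₗ[k] W ⊗[k] X) (g : X →ₗ[k] A) :
    X →ₗ[k] Module.End k (A × (W ⊗[k] A)) :=
  LinearMap.mk₂ k
    (fun x p => (α • (g x * p.1), h x ⊗ₜ p.1 + γ • crossAct C g x p.2))
    (fun _ _ _ => by
      ext1
      · simp [add_mul]
      · simp [TensorProduct.add_tmul]; abel)
    (fun c _ _ => by
      ext1
      · simp [smul_comm c]
      · simp [TensorProduct.smul_tmul', smul_comm c])
    (fun _ _ _ => by
      ext1
      · simp [mul_add]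
      · simp [TensorProduct.tmul_add]; abel)
    (fun c _ _ => by
      ext1
      · simp [smul_comm c]
      · simp [smul_comm c])

theorem triAct_apply (α γ : k) (h : X →ₗ[k] W) (C : X ⊗[k] W →ₗ[k] W ⊗[k] X) (g : X →ₗ[k] A)
    (x : X) (p : A × (W ⊗[k] A)) :
    triAct α γ h C g x p = (α • (g x * p.1), h x ⊗ₜ p.1 + γ • crossAct C g x p.2) := rfl

/-- The two summands that depend on `a` in the second component form the corner of the product
matrix. They alone impose conditions beyond those on the diagonal blocks. -/
theorem mulMap_triAct (α γ α' γ' : k) (h : X →ₗ[k] W) (C : X ⊗[k] W →ₗ[k] W ⊗[k] X) (g : X →ₗ[k] A)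
    (h' : Y →ₗ[k] W) (C' : Y ⊗[k] W →ₗ[k] W ⊗[k] Y) (g' : Y →ₗ[k] A)
    (z : X ⊗[k] Y) (a : A) (t : W ⊗[k] A) :
    mulMap (triAct α γ h C g) (triAct α' γ' h' C' g') z (a, t)
      = ((α * α') • (mulMap g g' z * a),
          α' • TensorProduct.map h (mulConst g' a) z
            + γ • (mulConst g a).lTensor W (C (h'.lTensor X z))
            + (γ * γ') • mulMap (crossAct C g) (crossAct C' g') z t) := by
  induction z using TensorProduct.induction_on with
  | zero => ext1 <;> simp
  | tmul x y =>
    simp [triAct_apply, crossAct_tmul, Module.End.mul_apply, mul_assoc, smul_smul, add_assoc]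
  | add s t hs ht =>
    rw [map_add, LinearMap.add_apply, hs, ht]
    ext1
    · simp [add_mul]
    · simp; abel

end CrossAct

/-! ### Contraction of strands and multiplication of a strand back into the algebra -/

section Contract

variable {k : Type*} [Field k] {A B W X Y M N : Type*} [Ring A] [Algebra k A]
  [AddCommGroup B] [Module k B] [AddCommGroup W] [Module k W] [AddCommGroup X] [Module k X]
  [AddCommGroup Y] [Module k Y] [AddCommGroup M] [Module k M] [AddCommGroup N] [Module k N]

/-- The contraction `Y ⊗ (W ⊗ M) → M` by a pairing `Y ⊗ W → k`. -/
def contr (e : Y ⊗[k] W →ₗ[k] k) (M : Type*) [AddCommGroup M] [Module k M] :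
    Y ⊗[k] (W ⊗[k] M) →ₗ[k] M :=
  (TensorProduct.lid k M).toLinearMap ∘ₗ e.rTensor M ∘ₗ
    (TensorProduct.assoc k Y W M).symm.toLinearMap

@[simp]
theorem contr_tmul (e : Y ⊗[k] W →ₗ[k] k) (y : Y) (w : W) (m : M) :
    contr e M (y ⊗ₜ (w ⊗ₜ m)) = e (y ⊗ₜ w) • m := by
  simp [contr]

@[simp]
theorem contr_assoc (e : Y ⊗[k] W →ₗ[k] k) (z : Y ⊗[k] W) (m : M) :
    contr e M (TensorProduct.assoc k _ _ _ (z ⊗ₜ m)) = e z • m := by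
  simp [contr]

theorem contr_comp (e : Y ⊗[k] W →ₗ[k] k) (T : X ⊗[k] B →ₗ[k] Y ⊗[k] W) :
    contr (e ∘ₗ T) M = contr e M ∘ₗ onFirst T M := by
  ext x b m
  simp

theorem contr_lTensor (e : Y ⊗[k] W →ₗ[k] k) (f : M →ₗ[k] N) (y : Y) (t : W ⊗[k] M) :
    contr e N (y ⊗ₜ f.lTensor W t) = f (contr e M (y ⊗ₜ t)) := by
  induction t using TensorProduct.induction_on with
  | zero => simp
  | tmul w m => simp
  | add s t hs ht => simp only [TensorProduct.tmul_add, map_add, hs, ht]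

theorem contr_lTensor_flip_crossAct (e : Y ⊗[k] W →ₗ[k] k) (C : X ⊗[k] W →ₗ[k] W ⊗[k] X)
    (g : X →ₗ[k] A) (z : Y ⊗[k] X) (w : W) (a : A) :
    contr e A (((crossAct C g).flip (w ⊗ₜ a)).lTensor Y z)
      = mulConst g a (contr e X (C.lTensor Y (TensorProduct.assoc k _ _ _ (z ⊗ₜ w)))) := by
  induction z using TensorProduct.induction_on with
  | zero => simp
  | tmul y x => simp [crossAct_tmul, contr_lTensor]
  | add s t hs ht => simp only [TensorProduct.add_tmul, map_add, hs, ht]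

/-- The hypothesis `h` lets a strand `X` that crosses both legs of the cap `e` be pulled off it. The
crossings disappear and only the multiplication by `g x` remains. -/
theorem contr_lTensor_crossAct (e : Y ⊗[k] W →ₗ[k] k) (C : X ⊗[k] W →ₗ[k] W ⊗[k] X)
    (C' : X ⊗[k] Y →ₗ[k] Y ⊗[k] X) (g : X →ₗ[k] A)
    (h : contr e X ∘ₗ C.lTensor Y ∘ₗ onFirst C' W
      = (TensorProduct.rid k X).toLinearMap ∘ₗ e.lTensor X)
    (x : X) (y : Y) (t : W ⊗[k] A) :
    contr e A (((crossAct C g).flip t).lTensor Y (C' (x ⊗ₜ y))) = g x * contr e A (y ⊗ₜ t) := by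
  induction t using TensorProduct.induction_on with
  | zero => simp
  | add s t hs ht =>
    simp only [TensorProduct.tmul_add, map_add, hs, ht, LinearMap.lTensor_add, LinearMap.add_apply,
      mul_add]
  | tmul w a =>
    have h2 := LinearMap.congr_fun h (x ⊗ₜ (y ⊗ₜ w))
    simp only [LinearMap.comp_apply, onFirst_tmul] at h2
    rw [contr_lTensor_flip_crossAct, h2]
    simp

/-- The multiplication `X ⊗ A → A`, `x ⊗ a ↦ g(x) a`. -/
def leftMul (g : X →ₗ[k] A) : X ⊗[k] A →ₗ[k] A := LinearMap.mul' k A ∘ₗ g.rTensor A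

@[simp]
theorem leftMul_tmul (g : X →ₗ[k] A) (x : X) (a : A) : leftMul g (x ⊗ₜ a) = g x * a := by
  simp [leftMul]

theorem leftMul_crossAct (C : X ⊗[k] W →ₗ[k] W ⊗[k] X) (g : X →ₗ[k] A) (f : W →ₗ[k] A) (κ : k)
    (h : ∀ z, mulMap f g (C z) = κ • mulMap g f z) (x : X) (t : W ⊗[k] A) :
    leftMul f (crossAct C g x t) = κ • (g x * leftMul f t) := by
  induction t using TensorProduct.induction_on with
  | zero => simp
  | add s t hs ht => simp only [map_add, hs, ht, mul_add, smul_add]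
  | tmul w a =>
    have h1 : ∀ z : W ⊗[k] X, leftMul f ((mulConst g a).lTensor W z) = mulMap f g z * a := by
      intro z
      induction z using TensorProduct.induction_on with
      | zero => simp
      | tmul w x => simp [mul_assoc]
      | add s t hs ht => simp only [map_add, hs, ht, add_mul]
    rw [crossAct_tmul, h1, h]
    simp [mul_assoc]

theorem crossAct_lTensor_mulRight (C : X ⊗[k] W →ₗ[k] W ⊗[k] X) (g : X →ₗ[k] A) (x : X) (b : A)
    (t : W ⊗[k] A) :
    crossAct C g x ((LinearMap.mulRight k b).lTensor W t)
      = (LinearMap.mulRight k b).lTensor W (crossAct C g x t) := by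
  induction t using TensorProduct.induction_on with
  | zero => simp
  | add s t hs ht => simp only [map_add, hs, ht]
  | tmul w a =>
    have h : mulConst g (a * b) = LinearMap.mulRight k b ∘ₗ mulConst g a := by
      ext x
      simp [mul_assoc]
    rw [LinearMap.lTensor_tmul, crossAct_tmul, crossAct_tmul, LinearMap.mulRight_apply, h,
      LinearMap.lTensor_comp, LinearMap.comp_apply]

theorem crossAct_mem_map₂ (C : X ⊗[k] W →ₗ[k] W ⊗[k] X) (g : X →ₗ[k] A) {S S' : Submodule k A}
    (h : ∀ x, ∀ a ∈ S, g x * a ∈ S') (x : X) {t : W ⊗[k] A}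
    (ht : t ∈ Submodule.map₂ (TensorProduct.mk k W A) ⊤ S) :
    crossAct C g x t ∈ Submodule.map₂ (TensorProduct.mk k W A) ⊤ S' := by
  suffices H : Submodule.map₂ (TensorProduct.mk k W A) ⊤ S
      ≤ (Submodule.map₂ (TensorProduct.mk k W A) ⊤ S').comap (crossAct C g x) from H ht
  refine Submodule.map₂_le.2 fun w _ a ha => ?_
  rw [Submodule.mem_comap, TensorProduct.mk_apply, crossAct_tmul]
  generalize C (x ⊗ₜ w) = z
  induction z using TensorProduct.induction_on with
  | zero => simp
  | add s t hs ht => simpa only [map_add] using add_mem hs ht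
  | tmul w x => exact Submodule.apply_mem_map₂ _ Submodule.mem_top (h x a ha)

theorem moveLeft_cons (C : X ⊗[k] W →ₗ[k] W ⊗[k] X) (g : X →ₗ[k] A) (x : X) (l : List X) (w : W) :
    moveLeft C g (x :: l) w = crossAct C g x (moveLeft C g l w) := by
  suffices h : ∀ t : W ⊗[k] A, (LinearMap.mul' k A).lTensor W (TensorProduct.assoc k W A A
      ((g.lTensor W).rTensor A (C.rTensor A ((TensorProduct.assoc k X W A).symm (x ⊗ₜ t)))))
      = crossAct C g x t from h _
  intro t
  induction t using TensorProduct.induction_on with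
  | zero => simp
  | add s t hs ht => simp only [TensorProduct.tmul_add, map_add, hs, ht]
  | tmul w a =>
    rw [crossAct_tmul]
    simp only [TensorProduct.assoc_symm_tmul, LinearMap.rTensor_tmul]
    generalize C (x ⊗ₜ w) = z
    induction z using TensorProduct.induction_on with
    | zero => simp
    | add s t hs ht => simp only [TensorProduct.add_tmul, map_add, hs, ht]
    | tmul w x => simp

theorem contr_contractRight_tmul (a : B) (t : Dual k B ⊗[k] M) :
    contr (contractRight k B) M (a ⊗ₜ t) = dualTensorHom k B M t a := by
  induction t using TensorProduct.induction_on with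
  | zero => simp
  | tmul w m => simp
  | add s t hs ht => simp only [TensorProduct.tmul_add, map_add, hs, ht, LinearMap.add_apply]

/-- The defining identity `(ev ⊗ 1)(1 ⊗ T♯) = (1 ⊗ ev)(T ⊗ 1)`. -/
theorem contr_contractRight_sharp [Module.Finite k B] (T : B ⊗[k] M →ₗ[k] M ⊗[k] B) :
    contr (contractRight k B) M ∘ₗ (sharp T).lTensor B
      = (TensorProduct.rid k M).toLinearMap ∘ₗ (contractRight k B).lTensor M
          ∘ₗ onFirst T (Dual k B) := by
  have h : ∀ (z : M ⊗[k] B) (φ : Dual k B), TensorProduct.rid k M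
      ((contractRight k B).lTensor M (TensorProduct.assoc k _ _ _ (z ⊗ₜ φ)))
      = evalRight M φ z := by
    intro z φ
    induction z using TensorProduct.induction_on with
    | zero => simp
    | tmul w m => simp [evalRight_tmul]
    | add s t hs ht => simp only [TensorProduct.add_tmul, map_add, hs, ht]
  ext b m φ
  simp [contr_contractRight_tmul, dualTensorHom_sharp, h]

end Contract

universe u v

variable {k : Type u} [Field k] {V : Type v} [AddCommGroup V] [Module k V]
  [FiniteDimensional k V]

/-! ### Braid relations with inverse crossings, the quadratic relation, and `coev` -/

section Crossings

variable {q : k} {R : V ⊗[k] V →ₗ[k] V ⊗[k] V}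

theorem braidInvVV_comp (hR : IsHecke q R) : braidInvVV hR ∘ₗ R = LinearMap.id :=
  LinearMap.ext (LinearEquiv.ofBijective R hR.bijective).symm_apply_apply

theorem comp_braidInvVV (hR : IsHecke q R) : R ∘ₗ braidInvVV hR = LinearMap.id :=
  LinearMap.ext (LinearEquiv.ofBijective R hR.bijective).apply_symm_apply

theorem braidDualV_comp (hR : IsHecke q R) : braidDualV hR ∘ₗ sharp R = LinearMap.id :=
  LinearMap.ext (LinearEquiv.ofBijective (sharp R) hR.sharp_bijective).symm_apply_apply

theorem comp_braidDualV (hR : IsHecke q R) : sharp R ∘ₗ braidDualV hR = LinearMap.id :=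
  LinearMap.ext (LinearEquiv.ofBijective (sharp R) hR.sharp_bijective).apply_symm_apply

theorem comp_braidInvDualDual (hR : IsHecke q R) :
    sharp (sharp R) ∘ₗ braidInvDualDual hR = LinearMap.id :=
  LinearMap.ext (LinearEquiv.ofBijective (sharp (sharp R))
    (sharp_sharp_bijective hR.bijective)).apply_symm_apply

theorem braid_sharp (hR : IsHecke q R) :
    onFirst (sharp R) V ∘ₗ (sharp R).lTensor V ∘ₗ onFirst R (Dual k V)
      = R.lTensor (Dual k V) ∘ₗ onFirst (sharp R) V ∘ₗ (sharp R).lTensor V :=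
  (sharp_braid R R R hR.braid).symm

theorem braid_sharp_sharp (hR : IsHecke q R) :
    onFirst (sharp (sharp R)) V ∘ₗ (sharp R).lTensor (Dual k V) ∘ₗ onFirst (sharp R) (Dual k V)
      = (sharp R).lTensor (Dual k V) ∘ₗ onFirst (sharp R) (Dual k V)
          ∘ₗ (sharp (sharp R)).lTensor V :=
  (sharp_braid R (sharp R) (sharp R) (braid_sharp hR)).symm

theorem braid_sharp_sharp_sharp (hR : IsHecke q R) :
    onFirst (sharp (sharp R)) (Dual k V) ∘ₗ (sharp (sharp R)).lTensor (Dual k V)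
        ∘ₗ onFirst (sharp (sharp R)) (Dual k V)
      = (sharp (sharp R)).lTensor (Dual k V) ∘ₗ onFirst (sharp (sharp R)) (Dual k V)
          ∘ₗ (sharp (sharp R)).lTensor (Dual k V) :=
  (sharp_braid (sharp R) (sharp R) (sharp (sharp R)) (braid_sharp_sharp hR)).symm

section Inverse

variable {A A' B B' : Type*} [AddCommGroup A] [Module k A] [AddCommGroup A'] [Module k A']
  [AddCommGroup B] [Module k B] [AddCommGroup B'] [Module k B']

theorem onFirst_onFirst_of_comp_eq_id {S : A' ⊗[k] B' →ₗ[k] A ⊗[k] B}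
    {T : A ⊗[k] B →ₗ[k] A' ⊗[k] B'} (h : S ∘ₗ T = LinearMap.id) {C : Type*} [AddCommGroup C]
    [Module k C] (x : A ⊗[k] (B ⊗[k] C)) : onFirst S C (onFirst T C x) = x := by
  rw [← LinearMap.comp_apply, onFirst_comp, h, onFirst_id, LinearMap.id_apply]

end Inverse

theorem lTensor_lTensor_of_comp_eq_id {A B C : Type*} [AddCommMonoid A] [Module k A]
    [AddCommMonoid B] [Module k B] [AddCommMonoid C] [Module k C] {S : B →ₗ[k] A} {T : A →ₗ[k] B}
    (h : S ∘ₗ T = LinearMap.id) (x : C ⊗[k] A) :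
    S.lTensor C (T.lTensor C x) = x := by
  rw [← LinearMap.comp_apply, ← LinearMap.lTensor_comp, h, LinearMap.lTensor_id, LinearMap.id_apply]

theorem braid_inv (hR : IsHecke q R) :
    onFirst (braidInvVV hR) V ∘ₗ (braidInvVV hR).lTensor V ∘ₗ onFirst R V
      = R.lTensor V ∘ₗ onFirst (braidInvVV hR) V ∘ₗ (braidInvVV hR).lTensor V := by
  -- Writing `x` as the image of `y` under two invertible crossings turns the claim into the
  -- ordinary braid relation at `y`, in which the inverse crossings cancel.
  refine LinearMap.ext fun x => ?_
  obtain ⟨y, rfl⟩ : ∃ y, R.lTensor V (onFirst R V y) = x :=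
    ⟨onFirst (braidInvVV hR) V ((braidInvVV hR).lTensor V x), by
      rw [onFirst_onFirst_of_comp_eq_id (comp_braidInvVV hR),
        lTensor_lTensor_of_comp_eq_id (comp_braidInvVV hR)]⟩
  have h : onFirst R V (R.lTensor V (onFirst R V y)) = R.lTensor V (onFirst R V (R.lTensor V y)) :=
    LinearMap.congr_fun hR.braid y
  simp only [LinearMap.comp_apply, h, onFirst_onFirst_of_comp_eq_id (braidInvVV_comp hR),
    lTensor_lTensor_of_comp_eq_id (braidInvVV_comp hR)]

theorem braid_inv_sharp (hR : IsHecke q R) :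
    onFirst (braidDualV hR) V ∘ₗ (braidInvVV hR).lTensor (Dual k V) ∘ₗ onFirst (sharp R) V
      = (sharp R).lTensor V ∘ₗ onFirst (braidInvVV hR) (Dual k V) ∘ₗ (braidDualV hR).lTensor V := by
  refine LinearMap.ext fun x => ?_
  obtain ⟨y, rfl⟩ : ∃ y, (sharp R).lTensor V (onFirst R (Dual k V) y) = x :=
    ⟨onFirst (braidInvVV hR) _ ((braidDualV hR).lTensor V x), by
      rw [onFirst_onFirst_of_comp_eq_id (comp_braidInvVV hR),
        lTensor_lTensor_of_comp_eq_id (comp_braidDualV hR)]⟩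
  have h := LinearMap.congr_fun (braid_sharp hR) y
  simp only [LinearMap.comp_apply] at h
  simp only [LinearMap.comp_apply, h, onFirst_onFirst_of_comp_eq_id (braidInvVV_comp hR),
    lTensor_lTensor_of_comp_eq_id (braidInvVV_comp hR),
    onFirst_onFirst_of_comp_eq_id (braidDualV_comp hR),
    lTensor_lTensor_of_comp_eq_id (braidDualV_comp hR)]

theorem braid_inv_sharp_sharp (hR : IsHecke q R) :
    onFirst (braidDualV hR) (Dual k V) ∘ₗ (braidDualV hR).lTensor (Dual k V)
        ∘ₗ onFirst (sharp (sharp R)) V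
      = (sharp (sharp R)).lTensor V ∘ₗ onFirst (braidDualV hR) (Dual k V)
          ∘ₗ (braidDualV hR).lTensor (Dual k V) := by
  refine LinearMap.ext fun x => ?_
  obtain ⟨y, rfl⟩ : ∃ y, (sharp R).lTensor (Dual k V) (onFirst (sharp R) (Dual k V) y) = x :=
    ⟨onFirst (braidDualV hR) _ ((braidDualV hR).lTensor _ x), by
      rw [onFirst_onFirst_of_comp_eq_id (comp_braidDualV hR),
        lTensor_lTensor_of_comp_eq_id (comp_braidDualV hR)]⟩
  have h := LinearMap.congr_fun (braid_sharp_sharp hR) y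
  simp only [LinearMap.comp_apply] at h
  simp only [LinearMap.comp_apply, h,
    onFirst_onFirst_of_comp_eq_id (braidDualV_comp hR),
    lTensor_lTensor_of_comp_eq_id (braidDualV_comp hR)]

/-- The pairing `V^∨ ⊗ V --c--> V ⊗ V^∨ --ev--> k`. -/
def evBraid (hR : IsHecke q R) : Dual k V ⊗[k] V →ₗ[k] k :=
  contractRight k V ∘ₗ braidDualV hR

theorem evBraid_sharp (hR : IsHecke q R) (z : V ⊗[k] Dual k V) :
    evBraid hR (sharp R z) = contractRight k V z :=
  congrArg (contractRight k V) (LinearMap.congr_fun (braidDualV_comp hR) z)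

/-- A strand `V^∨` is pulled across the cap `ev ∘ c`: the braid relation carries it past the
crossing `c`, and the defining identity of `♯` carries it past `ev`. The two crossings that are left
are inverse to each other. -/
theorem contr_evBraid_dual (hR : IsHecke q R) :
    contr (evBraid hR) (Dual k V) ∘ₗ (braidDualV hR).lTensor (Dual k V)
        ∘ₗ onFirst (sharp (sharp R)) V
      = (TensorProduct.rid k (Dual k V)).toLinearMap ∘ₗ (evBraid hR).lTensor (Dual k V) := by
  rw [evBraid, contr_comp, LinearMap.comp_assoc, braid_inv_sharp_sharp, ← LinearMap.comp_assoc,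
    contr_contractRight_sharp, LinearMap.lTensor_comp]
  refine LinearMap.ext fun x => ?_
  simp only [LinearMap.comp_apply, onFirst_onFirst_of_comp_eq_id (comp_braidDualV hR)]

theorem contr_evBraid_V (hR : IsHecke q R) :
    contr (evBraid hR) V ∘ₗ (braidInvVV hR).lTensor (Dual k V) ∘ₗ onFirst (sharp R) V
      = (TensorProduct.rid k V).toLinearMap ∘ₗ (evBraid hR).lTensor V := by
  rw [evBraid, contr_comp, LinearMap.comp_assoc, braid_inv_sharp, ← LinearMap.comp_assoc,
    contr_contractRight_sharp, LinearMap.lTensor_comp]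
  refine LinearMap.ext fun x => ?_
  simp only [LinearMap.comp_apply, onFirst_onFirst_of_comp_eq_id (comp_braidInvVV hR)]

theorem hecke_apply (hR : IsHecke q R) (z : V ⊗[k] V) : R (R z) = (q - q⁻¹) • R z + z := by
  have h := LinearMap.congr_fun hR.quadratic z
  have hq := hR.q_ne_zero
  simp only [LinearMap.comp_apply, LinearMap.sub_apply, LinearMap.add_apply, LinearMap.smul_apply,
    LinearMap.id_apply, map_add, map_smul, LinearMap.zero_apply, smul_sub, smul_smul,
    inv_mul_cancel₀ hq, one_smul] at h
  rw [sub_smul, ← sub_eq_zero, ← h]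
  abel

theorem braidInvVV_apply (hR : IsHecke q R) (z : V ⊗[k] V) :
    braidInvVV hR z = R z - (q - q⁻¹) • z := by
  obtain ⟨y, rfl⟩ := hR.bijective.2 z
  rw [← LinearMap.comp_apply, braidInvVV_comp, hecke_apply hR]
  simp

/-- `R♯♯` is the transpose of `R` for a perfect pairing, so it satisfies the same quadratic
equation. -/
theorem hecke_sharp_sharp (hR : IsHecke q R) (w : Dual k V ⊗[k] Dual k V) :
    sharp (sharp R) (sharp (sharp R) w) = (q - q⁻¹) • sharp (sharp R) w + w := by
  apply (TensorProduct.comm k _ _).injective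
  apply (TensorProduct.dualDistribEquiv k V V).injective
  refine LinearMap.ext fun z => ?_
  change TensorProduct.dualDistrib k V V _ z = TensorProduct.dualDistrib k V V _ z
  simp only [pairing_sharp_sharp, map_add, map_smul, LinearMap.add_apply, LinearMap.smul_apply,
    hecke_apply hR]

theorem dualTensorHom_coevOne : dualTensorHom k V V (coevOne k V) = LinearMap.id :=
  (dualTensorEquivHom k V V).apply_symm_apply LinearMap.id

theorem lTensor_coevOne {M : Type*} [AddCommGroup M] [Module k M] (t : Dual k V ⊗[k] M) :
    (dualTensorHom k V M t).lTensor (Dual k V) (coevOne k V) = t := by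
  refine dualTensor_ext fun a => ?_
  rw [dualTensorHom_lTensor, dualTensorHom_coevOne, LinearMap.id_apply]

/-- A strand slides through the cup `coev`, which exchanges `R` on one leg for `R♯` on the other. -/
theorem coevOne_braid (w : V) :
    R.lTensor (Dual k V) (TensorProduct.assoc k _ _ _ (coevOne k V ⊗ₜ w))
      = onFirst (sharp R) V (w ⊗ₜ coevOne k V) := by
  refine dualTensor_ext fun a => ?_
  rw [dualTensorHom_lTensor, dualTensorHom_assoc, dualTensorHom_onFirst_sharp,
    dualTensorHom_coevOne, LinearMap.lTensor_id]
  rfl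

/-- Substitute `R⁻¹ = R - (q - q⁻¹)`. In the `R` term, sliding `w` through the cup produces an `R♯`
that cancels `c`, and the cup and cap straighten to the identity. In the other term they close up to
a loop of value `dim8`. -/
theorem contr_coevOne (hR : IsHecke q R) (w : V) :
    contr (evBraid hR) V ((braidInvVV hR).lTensor (Dual k V)
        (TensorProduct.assoc k _ _ _ (coevOne k V ⊗ₜ w)))
      = (1 - (q - q⁻¹) * dim8 hR) • w := by
  have h : braidInvVV hR = R + (-(q - q⁻¹)) • LinearMap.id :=
    LinearMap.ext fun z => by
      rw [braidInvVV_apply, sub_eq_add_neg, ← neg_smul]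
      rfl
  rw [h, LinearMap.lTensor_add, LinearMap.lTensor_smul, LinearMap.add_apply, coevOne_braid, map_add]
  simp only [LinearMap.lTensor_id, LinearMap.smul_apply, LinearMap.id_apply, map_smul, contr_assoc]
  rw [evBraid, contr_comp, LinearMap.comp_apply,
    onFirst_onFirst_of_comp_eq_id (braidDualV_comp hR), contr_contractRight_tmul,
    dualTensorHom_coevOne, sub_smul, one_smul, mul_smul, neg_smul, ← sub_eq_add_neg]
  rfl

end Crossings

/-! ### Arithmetic of `q`-integers -/

section QInt

omit [FiniteDimensional k V] in
theorem qInt_zero (q : k) : qInt q 0 = 0 := by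
  change ∑ i ∈ Finset.range 0, _ = _
  simp

theorem qInt_add_one {q : k} (hq : q ≠ 0) (z : ℤ) : qInt q (z + 1) = q ^ (-z) + q * qInt q z := by
  rcases z with n | n
  · change ∑ i ∈ Finset.range (n + 1), q ^ (((n + 1 : ℕ) : ℤ) - 1 - 2 * (i : ℤ))
      = q ^ (-(n : ℤ)) + q * ∑ i ∈ Finset.range n, q ^ ((n : ℤ) - 1 - 2 * (i : ℤ))
    rw [Finset.sum_range_succ, Finset.mul_sum, add_comm]
    congr 1
    · congr 1; push_cast; ring
    · refine Finset.sum_congr rfl fun i _ => ?_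
      rw [← zpow_one_add₀ hq]
      congr 1; push_cast; ring
  -- `Int.negSucc n` is `-(n + 1)`, so its sum has `n + 1` terms. In the form `h1`, removing the
  -- term `i = 0` leaves the sum for `-n` up to a factor `q`, and the removed term cancels `q ^ (n +
  -- 1)`.
  · have h1 : ∀ n : ℕ, qInt q (-(n : ℤ))
        = -∑ i ∈ Finset.range n, q ^ ((n : ℤ) - 1 - 2 * (i : ℤ)) := by
      rintro (_ | n)
      · simp [qInt_zero]
      · change -∑ i ∈ Finset.range (n + 1), _ = _
        push_cast
        simp only [add_sub_cancel_right]
    have h2 : Int.negSucc n + 1 = -(n : ℤ) := by omega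
    have h3 : -Int.negSucc n = (n : ℤ) + 1 := by omega
    have h4 : Int.negSucc n = -((n + 1 : ℕ) : ℤ) := by omega
    have h5 : q * ∑ i ∈ Finset.range n, q ^ (((n + 1 : ℕ) : ℤ) - 1 - 2 * ((i + 1 : ℕ) : ℤ))
        = ∑ i ∈ Finset.range n, q ^ ((n : ℤ) - 1 - 2 * (i : ℤ)) := by
      rw [Finset.mul_sum]
      refine Finset.sum_congr rfl fun i _ => ?_
      rw [← zpow_one_add₀ hq]
      congr 1; push_cast; ring
    have h6 : q * q ^ (((n + 1 : ℕ) : ℤ) - 1 - 2 * ((0 : ℕ) : ℤ)) = q ^ ((n : ℤ) + 1) := by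
      rw [← zpow_one_add₀ hq]
      congr 1; push_cast; ring
    rw [h2, h3, h4, h1, h1, Finset.sum_range_succ', mul_neg, mul_add, h5, h6]
    ring

theorem qInt_add {q : k} (hq : q ≠ 0) (x y : ℤ) :
    qInt q (x + y) = q ^ y * qInt q x + q ^ (-x) * qInt q y := by
  induction y using Int.induction_on with
  | zero => simp [qInt_zero]
  | succ y ih =>
    rw [← add_assoc, qInt_add_one hq, ih, qInt_add_one hq y, zpow_add_one₀ hq, neg_add,
      zpow_add₀ hq]
    ring
  | pred y ih =>
    have h1 := qInt_add_one hq (x + (-(y : ℤ) - 1))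
    have h2 := qInt_add_one hq (-(y : ℤ) - 1)
    rw [show x + (-(y : ℤ) - 1) + 1 = x + -(y : ℤ) by ring, ih] at h1
    rw [sub_add_cancel] at h2
    rw [h2, neg_add, zpow_add₀ hq] at h1
    apply mul_left_cancel₀ hq
    have h3 : q ^ (-(y : ℤ)) = q * q ^ (-(y : ℤ) - 1) := by
      rw [← zpow_one_add₀ hq]; congr 1; ring
    rw [h3] at h1
    linear_combination -h1

theorem qInt_neg {q : k} (hq : q ≠ 0) (z : ℤ) : qInt q (-z) = -qInt q z := by
  have h := qInt_add hq z (-z)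
  rw [add_neg_cancel, qInt_zero, ← mul_add] at h
  have := (mul_eq_zero.1 h.symm).resolve_left (zpow_ne_zero _ hq)
  exact eq_neg_of_add_eq_zero_right this

theorem sub_inv_mul_qInt {q : k} (hq : q ≠ 0) (n : ℕ) :
    (q - q⁻¹) * qInt q n = q ^ (n : ℤ) - q ^ (-(n : ℤ)) := by
  induction n with
  | zero => simp [qInt_zero]
  | succ n ih =>
    push_cast
    rw [qInt_add_one hq, mul_add, mul_left_comm, ih, neg_add, zpow_add₀ hq, zpow_add₀ hq]
    simp
    ring

/-- The terms with `d` combine through `(q - q⁻¹)[n] = q^n - q^{-n}`; the others are the addition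
formula for `[m - n]`. -/
theorem laplacian_scalar {q : k} (hq : q ≠ 0) (d : k) (n m : ℕ) :
    d * q ^ (-((n : ℤ) + m)) - (1 - (q - q⁻¹) * d) * (q ^ (-(m : ℤ)) * qInt q n)
        + q ^ (-(n : ℤ)) * qInt q m
      = q ^ ((n : ℤ) - m) * d + qInt q ((m : ℤ) - n) := by
  have h := sub_inv_mul_qInt hq n
  rw [sub_eq_add_neg (m : ℤ), qInt_add hq, qInt_neg hq, neg_add, zpow_add₀ hq,
    sub_eq_add_neg (n : ℤ), zpow_add₀ hq]
  linear_combination d * q ^ (-(m : ℤ)) * h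

end QInt

/-! ### Relations and universal property of `K(V)` -/

section Algebra

variable {q : k} {R : V ⊗[k] V →ₗ[k] V ⊗[k] V}

omit [FiniteDimensional k V] in
theorem map_mulMap {A B X Y : Type*} [Ring A] [Algebra k A] [Ring B] [Algebra k B]
    [AddCommGroup X] [Module k X] [AddCommGroup Y] [Module k Y] (F : A →ₐ[k] B)
    (f : X →ₗ[k] A) (g : Y →ₗ[k] A) (z : X ⊗[k] Y) :
    F (mulMap f g z) = mulMap (F.toLinearMap ∘ₗ f) (F.toLinearMap ∘ₗ g) z := by
  induction z using TensorProduct.induction_on with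
  | zero => simp
  | tmul x y => simp
  | add s t hs ht => simp only [map_add, hs, ht]

theorem proj_rel {x y : TensorAlgebra k (V × Dual k V)} (h : KoszulRel q R x y) :
    proj q R x = proj q R y :=
  RingQuot.mkAlgHom_rel k h

theorem mulMap_gV_gV (z : V ⊗[k] V) :
    mulMap (gV q R) (gV q R) (R z) = -q⁻¹ • mulMap (gV q R) (gV q R) z := by
  suffices h : mulMap (gV q R) (gV q R) ∘ₗ R = -q⁻¹ • mulMap (gV q R) (gV q R) from
    LinearMap.congr_fun h z
  refine TensorProduct.ext' fun v w => ?_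
  have h := proj_rel (KoszulRel.exterior (q := q) (R := R) v w)
  rw [map_mulMap, map_smul, map_mul] at h
  exact h.trans (by simp [gV])

theorem mulMap_gDual_gV (z : V ⊗[k] Dual k V) :
    mulMap (gDual q R) (gV q R) (sharp R z) = q • mulMap (gV q R) (gDual q R) z := by
  suffices h : mulMap (gDual q R) (gV q R) ∘ₗ sharp R = q • mulMap (gV q R) (gDual q R) from
    LinearMap.congr_fun h z
  refine TensorProduct.ext' fun v ξ => ?_
  have h := proj_rel (KoszulRel.mixed (q := q) (R := R) v ξ)
  rw [map_mulMap, map_smul, map_mul] at h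
  exact h.trans (by simp [gV, gDual])

theorem mulMap_gDual_gDual (z : Dual k V ⊗[k] Dual k V) :
    mulMap (gDual q R) (gDual q R) (sharp (sharp R) z)
      = q • mulMap (gDual q R) (gDual q R) z := by
  suffices h : mulMap (gDual q R) (gDual q R) ∘ₗ sharp (sharp R)
      = q • mulMap (gDual q R) (gDual q R) from LinearMap.congr_fun h z
  refine TensorProduct.ext' fun ξ η => ?_
  have h := proj_rel (KoszulRel.symmetric (q := q) (R := R) ξ η)
  rw [map_mulMap, map_smul, map_mul] at h
  exact h.trans (by simp [gDual])

/-- The universal property of `K(V)`. -/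
def koszulLift {B : Type*} [Ring B] [Algebra k B] (f : V →ₗ[k] B) (g : Dual k V →ₗ[k] B)
    (h₁ : ∀ z, mulMap f f (R z) = -q⁻¹ • mulMap f f z)
    (h₂ : ∀ z, mulMap g f (sharp R z) = q • mulMap f g z)
    (h₃ : ∀ z, mulMap g g (sharp (sharp R) z) = q • mulMap g g z) :
    KoszulAlgebra q R →ₐ[k] B :=
  RingQuot.liftAlgHom k ⟨TensorAlgebra.lift k (f.coprod g), by
    have hV : (TensorAlgebra.lift k (f.coprod g)).toLinearMap ∘ₗ tV k V = f :=
      LinearMap.ext fun _ => by simp [tV]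
    have hD : (TensorAlgebra.lift k (f.coprod g)).toLinearMap ∘ₗ tDual k V = g :=
      LinearMap.ext fun _ => by simp [tDual]
    have hV' : ∀ v, TensorAlgebra.lift k (f.coprod g) (tV k V v) = f v := LinearMap.congr_fun hV
    have hD' : ∀ ξ, TensorAlgebra.lift k (f.coprod g) (tDual k V ξ) = g ξ :=
      LinearMap.congr_fun hD
    rintro _ _ (⟨v, w⟩ | ⟨v, ξ⟩ | ⟨ξ, η⟩)
    · rw [map_mulMap, hV, h₁, map_smul, map_mul, mulMap_tmul, hV', hV']
    · rw [map_mulMap, hV, hD, h₂, map_smul, map_mul, mulMap_tmul, hV', hD']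
    · rw [map_mulMap, hD, h₃, map_smul, map_mul, mulMap_tmul, hD', hD']⟩

section Lift

variable {B : Type*} [Ring B] [Algebra k B] (f : V →ₗ[k] B) (g : Dual k V →ₗ[k] B)
    (h₁ : ∀ z, mulMap f f (R z) = -q⁻¹ • mulMap f f z)
    (h₂ : ∀ z, mulMap g f (sharp R z) = q • mulMap f g z)
    (h₃ : ∀ z, mulMap g g (sharp (sharp R) z) = q • mulMap g g z)

theorem koszulLift_gV (v : V) : koszulLift f g h₁ h₂ h₃ (gV q R v) = f v :=
  (RingQuot.liftAlgHom_mkAlgHom_apply k _ _ _).trans (by simp [tV])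

theorem koszulLift_gDual (ξ : Dual k V) : koszulLift f g h₁ h₂ h₃ (gDual q R ξ) = g ξ :=
  (RingQuot.liftAlgHom_mkAlgHom_apply k _ _ _).trans (by simp [tDual])

end Lift

theorem koszul_induction {p : KoszulAlgebra q R → Prop} (one : p 1)
    (gV_mul : ∀ v x, p x → p (gV q R v * x)) (gDual_mul : ∀ ξ x, p x → p (gDual q R ξ * x))
    (add : ∀ x y, p x → p y → p (x + y)) (smul : ∀ (c : k) x, p x → p (c • x))
    (x : KoszulAlgebra q R) : p x := by
  obtain ⟨a, rfl⟩ : ∃ a, proj q R a = x := RingQuot.mkAlgHom_surjective k (KoszulRel q R) x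
  suffices h : ∀ x, p x → p (proj q R a * x) by simpa using h 1 one
  induction a using TensorAlgebra.induction with
  | algebraMap r =>
    intro x hx
    rw [AlgHom.commutes, ← Algebra.smul_def]
    exact smul r x hx
  | ι w =>
    intro x hx
    have h : proj q R (TensorAlgebra.ι k w) = gV q R w.1 + gDual q R w.2 := by
      simp [gV, gDual, tV, tDual, ← map_add]
    rw [h, add_mul]
    exact add _ _ (gV_mul _ _ hx) (gDual_mul _ _ hx)
  | mul a b ha hb =>
    intro x hx
    rw [map_mul, mul_assoc]
    exact ha _ (hb _ hx)
  | add a b ha hb =>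
    intro x hx
    rw [map_add, add_mul]
    exact add _ _ (ha _ hx) (hb _ hx)

end Algebra

/-! ### The two twisted derivations of `K(V)` -/

section Derivations

variable {q : k} {R : V ⊗[k] V →ₗ[k] V ⊗[k] V}

section Twisted

variable {W : Type*} [AddCommGroup W] [Module k W]

/-- The conditions under which `gV v * x ↦ hV v ⊗ α^deg(x) x + γ v · x` and
`gDual ξ * x ↦ hD ξ ⊗ α^deg(x) x + γ' ξ · x` is compatible with the relations of `K(V)`, where `V`
and `V^∨` cross `W` by means of `CV` and `CD`. -/
structure IsTwist (q : k) (R : V ⊗[k] V →ₗ[k] V ⊗[k] V) (α γ γ' : k) (hV : V →ₗ[k] W)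
    (hD : Dual k V →ₗ[k] W) (CV : V ⊗[k] W →ₗ[k] W ⊗[k] V)
    (CD : Dual k V ⊗[k] W →ₗ[k] W ⊗[k] Dual k V) : Prop where
  exterior_braid : onFirst CV V ∘ₗ CV.lTensor V ∘ₗ onFirst R W
    = R.lTensor W ∘ₗ onFirst CV V ∘ₗ CV.lTensor V
  mixed_braid : onFirst CD V ∘ₗ CV.lTensor (Dual k V) ∘ₗ onFirst (sharp R) W
    = (sharp R).lTensor W ∘ₗ onFirst CV (Dual k V) ∘ₗ CD.lTensor V
  symmetric_braid : onFirst CD (Dual k V) ∘ₗ CD.lTensor (Dual k V) ∘ₗ onFirst (sharp (sharp R)) W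
    = (sharp (sharp R)).lTensor W ∘ₗ onFirst CD (Dual k V) ∘ₗ CD.lTensor (Dual k V)
  exterior (z : V ⊗[k] V) : α • hV.rTensor V (R z) + γ • CV (hV.lTensor V (R z))
    = -q⁻¹ • (α • hV.rTensor V z + γ • CV (hV.lTensor V z))
  mixed_dual (z : V ⊗[k] Dual k V) :
    α • hD.rTensor V (sharp R z) = q • γ • CV (hD.lTensor V z)
  mixed (z : V ⊗[k] Dual k V) :
    γ' • CD (hV.lTensor (Dual k V) (sharp R z)) = q • α • hV.rTensor (Dual k V) z
  symmetric (z : Dual k V ⊗[k] Dual k V) :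
    α • hD.rTensor (Dual k V) (sharp (sharp R) z)
        + γ' • CD (hD.lTensor (Dual k V) (sharp (sharp R) z))
      = q • (α • hD.rTensor (Dual k V) z + γ' • CD (hD.lTensor (Dual k V) z))

variable {α γ γ' : k} {hV : V →ₗ[k] W} {hD : Dual k V →ₗ[k] W} {CV : V ⊗[k] W →ₗ[k] W ⊗[k] V}
  {CD : Dual k V ⊗[k] W →ₗ[k] W ⊗[k] Dual k V}

omit [FiniteDimensional k V] in
theorem map_mulConst {A X Y : Type*} [Ring A] [Algebra k A] [AddCommGroup X] [Module k X]
    [AddCommGroup Y] [Module k Y] (h : X →ₗ[k] W) (g : Y →ₗ[k] A) (a : A) (z : X ⊗[k] Y) :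
    TensorProduct.map h (mulConst g a) z = (mulConst g a).lTensor W (h.rTensor Y z) := by
  rw [← LinearMap.comp_apply, LinearMap.lTensor_comp_rTensor]

/-- The representation of `K(V)` on `K(V) × (W ⊗ K(V))` by upper triangular operators. -/
def triRep (H : IsTwist q R α γ γ' hV hD CV CD) :
    KoszulAlgebra q R →ₐ[k] Module.End k (KoszulAlgebra q R × (W ⊗[k] KoszulAlgebra q R)) :=
  koszulLift (q := q) (R := R) (triAct α γ hV CV (gV q R)) (triAct α γ' hD CD (gDual q R))
    -- In each of the three relations the first component is the relation in `K(V)` itself. In the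
    -- second, the part that acts on `t` is handled by the braid relation, and the corner by the
    -- remaining fields of `H` multiplied by `a`.
    (fun z => by
      refine LinearMap.ext fun ⟨a, t⟩ => ?_
      rw [LinearMap.smul_apply, mulMap_triAct, mulMap_triAct, mulMap_gV_gV,
        mulMap_crossAct_braid _ _ _ _ R _ mulMap_gV_gV H.exterior_braid]
      have h := congrArg ((mulConst (gV q R) a).lTensor W) (H.exterior z)
      simp only [map_add, map_smul] at h
      ext1
      · simp only [Prod.smul_fst, smul_mul_assoc, smul_smul, mul_comm]
      · rw [map_mulConst, map_mulConst, h, LinearMap.smul_apply, Prod.smul_snd]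
        module)
    (fun z => by
      refine LinearMap.ext fun ⟨a, t⟩ => ?_
      rw [LinearMap.smul_apply, mulMap_triAct, mulMap_triAct, mulMap_gDual_gV,
        mulMap_crossAct_braid _ _ _ _ (sharp R) _ mulMap_gDual_gV H.mixed_braid]
      have h := congrArg ((mulConst (gV q R) a).lTensor W) (H.mixed_dual z)
      have h' := congrArg ((mulConst (gDual q R) a).lTensor W) (H.mixed z)
      simp only [map_smul] at h h'
      ext1
      · simp only [Prod.smul_fst, smul_mul_assoc, smul_smul, mul_comm]
      · rw [map_mulConst, map_mulConst, h, h', LinearMap.smul_apply, Prod.smul_snd]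
        module)
    (fun z => by
      refine LinearMap.ext fun ⟨a, t⟩ => ?_
      rw [LinearMap.smul_apply, mulMap_triAct, mulMap_triAct, mulMap_gDual_gDual,
        mulMap_crossAct_braid _ _ _ _ (sharp (sharp R)) _ mulMap_gDual_gDual H.symmetric_braid]
      have h := congrArg ((mulConst (gDual q R) a).lTensor W) (H.symmetric z)
      simp only [map_add, map_smul] at h
      ext1
      · simp only [Prod.smul_fst, smul_mul_assoc, smul_smul, mul_comm]
      · rw [map_mulConst, map_mulConst, h, LinearMap.smul_apply, Prod.smul_snd]
        module)

/-- The map which is multiplication by `α ^ (n + m)` in bidegree `(n, m)`. -/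
def twistScale (H : IsTwist q R α γ γ' hV hD CV CD) : KoszulAlgebra q R →ₗ[k] KoszulAlgebra q R :=
  LinearMap.fst k _ _ ∘ₗ LinearMap.applyₗ (1, 0) ∘ₗ (triRep H).toLinearMap

/-- The twisted derivation `K(V) → W ⊗ K(V)`. -/
def twistDeriv (H : IsTwist q R α γ γ' hV hD CV CD) :
    KoszulAlgebra q R →ₗ[k] W ⊗[k] KoszulAlgebra q R :=
  LinearMap.snd k _ _ ∘ₗ LinearMap.applyₗ (1, 0) ∘ₗ (triRep H).toLinearMap

variable (H : IsTwist q R α γ γ' hV hD CV CD)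

theorem twistScale_one : twistScale H 1 = 1 := by
  simp [twistScale]

theorem twistScale_gV_mul (v : V) (x : KoszulAlgebra q R) :
    twistScale H (gV q R v * x) = α • (gV q R v * twistScale H x) := by
  simp [twistScale, triRep, koszulLift_gV, triAct_apply, Module.End.mul_apply]

theorem twistScale_gDual_mul (ξ : Dual k V) (x : KoszulAlgebra q R) :
    twistScale H (gDual q R ξ * x) = α • (gDual q R ξ * twistScale H x) := by
  simp [twistScale, triRep, koszulLift_gDual, triAct_apply, Module.End.mul_apply]

theorem twistDeriv_one : twistDeriv H 1 = 0 := by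
  simp [twistDeriv]

theorem twistDeriv_gV_mul (v : V) (x : KoszulAlgebra q R) :
    twistDeriv H (gV q R v * x)
      = hV v ⊗ₜ twistScale H x + γ • crossAct CV (gV q R) v (twistDeriv H x) := by
  simp [twistScale, twistDeriv, triRep, koszulLift_gV, triAct_apply, Module.End.mul_apply]

theorem twistDeriv_gDual_mul (ξ : Dual k V) (x : KoszulAlgebra q R) :
    twistDeriv H (gDual q R ξ * x)
      = hD ξ ⊗ₜ twistScale H x + γ' • crossAct CD (gDual q R) ξ (twistDeriv H x) := by
  simp [twistScale, twistDeriv, triRep, koszulLift_gDual, triAct_apply, Module.End.mul_apply]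

end Twisted

/-- The corner condition on `V ⊗ V` is the quadratic relation in the form `R⁻¹ = R - (q - q⁻¹)`. The
mixed one says that `R♯` and `c` are inverse, and this needs `q α = γ'`. -/
theorem isTwist_V (hR : IsHecke q R) : IsTwist q R q⁻¹ (-1) 1 LinearMap.id 0 (braidInvVV hR)
    (braidDualV hR) where
  exterior_braid := braid_inv hR
  mixed_braid := braid_inv_sharp hR
  symmetric_braid := braid_inv_sharp_sharp hR
  exterior z := by
    have hq := hR.q_ne_zero
    have h := LinearMap.congr_fun (braidInvVV_comp hR) z
    rw [LinearMap.comp_apply, LinearMap.id_apply] at h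
    simp only [LinearMap.lTensor_id, LinearMap.rTensor_id, LinearMap.id_apply, h,
      braidInvVV_apply hR z]
    match_scalars
    · ring
    · field_simp
      ring
  mixed_dual z := by simp
  mixed z := by
    have h := LinearMap.congr_fun (braidDualV_comp hR) z
    rw [LinearMap.comp_apply, LinearMap.id_apply] at h
    simp [h, smul_smul, mul_inv_cancel₀ hR.q_ne_zero]
  symmetric z := by simp

/-- Here the quadratic relation of `R♯♯` gives the corner condition on `V^∨ ⊗ V^∨`, and the mixed
one only needs `q γ = α`. -/
theorem isTwist_dual (hR : IsHecke q R) : IsTwist q R 1 q⁻¹ q 0 LinearMap.id (sharp R)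
    (sharp (sharp R)) where
  exterior_braid := braid_sharp hR
  mixed_braid := braid_sharp_sharp hR
  symmetric_braid := braid_sharp_sharp_sharp hR
  exterior z := by simp
  mixed_dual z := by simp [smul_smul, mul_inv_cancel₀ hR.q_ne_zero]
  mixed z := by simp
  symmetric z := by
    have hq := hR.q_ne_zero
    simp only [LinearMap.lTensor_id, LinearMap.rTensor_id, LinearMap.id_apply,
      hecke_sharp_sharp hR z]
    match_scalars
    · field_simp
      ring
    · ring

/-- The automorphism of `K(V)` which is multiplication by `q ^ (-(n + m))` in bidegree `(n, m)`. -/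
def scale (hR : IsHecke q R) : KoszulAlgebra q R →ₗ[k] KoszulAlgebra q R :=
  twistScale (isTwist_V hR)

/-- The twisted derivation `K(V) → V ⊗ K(V)`. -/
def derivV (hR : IsHecke q R) : KoszulAlgebra q R →ₗ[k] V ⊗[k] KoszulAlgebra q R :=
  twistDeriv (isTwist_V hR)

/-- The twisted derivation `K(V) → V^∨ ⊗ K(V)`. -/
def derivDual (hR : IsHecke q R) : KoszulAlgebra q R →ₗ[k] Dual k V ⊗[k] KoszulAlgebra q R :=
  twistDeriv (isTwist_dual hR)

/-- The operators by which `V` acts on `V ⊗ K(V)`. -/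
abbrev actVV (hR : IsHecke q R) : V →ₗ[k] Module.End k (V ⊗[k] KoszulAlgebra q R) :=
  crossAct (braidInvVV hR) (gV q R)

/-- The operators by which `V^∨` acts on `V ⊗ K(V)`. -/
abbrev actDualV (hR : IsHecke q R) : Dual k V →ₗ[k] Module.End k (V ⊗[k] KoszulAlgebra q R) :=
  crossAct (braidDualV hR) (gDual q R)

theorem scale_one (hR : IsHecke q R) : scale hR 1 = 1 := twistScale_one _

theorem scale_gV_mul (hR : IsHecke q R) (v : V) (x : KoszulAlgebra q R) :
    scale hR (gV q R v * x) = q⁻¹ • (gV q R v * scale hR x) := twistScale_gV_mul _ _ _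

theorem scale_gDual_mul (hR : IsHecke q R) (ξ : Dual k V) (x : KoszulAlgebra q R) :
    scale hR (gDual q R ξ * x) = q⁻¹ • (gDual q R ξ * scale hR x) := twistScale_gDual_mul _ _ _

theorem derivV_one (hR : IsHecke q R) : derivV hR 1 = 0 := twistDeriv_one _

theorem derivV_gV_mul (hR : IsHecke q R) (v : V) (x : KoszulAlgebra q R) :
    derivV hR (gV q R v * x) = v ⊗ₜ scale hR x - actVV hR v (derivV hR x) :=
  (twistDeriv_gV_mul (isTwist_V hR) v x).trans (by rw [neg_one_smul, ← sub_eq_add_neg]; rfl)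

theorem derivV_gDual_mul (hR : IsHecke q R) (ξ : Dual k V) (x : KoszulAlgebra q R) :
    derivV hR (gDual q R ξ * x) = actDualV hR ξ (derivV hR x) :=
  (twistDeriv_gDual_mul (isTwist_V hR) ξ x).trans (by simp [derivV])

theorem derivDual_one (hR : IsHecke q R) : derivDual hR 1 = 0 := twistDeriv_one _

theorem derivDual_gV_mul (hR : IsHecke q R) (v : V) (x : KoszulAlgebra q R) :
    derivDual hR (gV q R v * x) = q⁻¹ • crossAct (sharp R) (gV q R) v (derivDual hR x) :=
  (twistDeriv_gV_mul (isTwist_dual hR) v x).trans (by simp [derivDual])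

theorem derivDual_gDual_mul (hR : IsHecke q R) (ξ : Dual k V) (x : KoszulAlgebra q R) :
    derivDual hR (gDual q R ξ * x)
      = ξ ⊗ₜ x + q • crossAct (sharp (sharp R)) (gDual q R) ξ (derivDual hR x) := by
  -- The degree twist is trivial because `α = 1`.
  have h : twistScale (isTwist_dual hR) x = x := by
    induction x using koszul_induction with
    | one => exact twistScale_one _
    | gV_mul v x ih => rw [twistScale_gV_mul, ih, one_smul]
    | gDual_mul ξ x ih => rw [twistScale_gDual_mul, ih, one_smul]
    | add x y hx hy => rw [map_add, hx, hy]
    | smul c x hx => rw [map_smul, hx]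
  exact (twistDeriv_gDual_mul (isTwist_dual hR) ξ x).trans (by rw [h]; rfl)

end Derivations

variable {q : k} {R : V ⊗[k] V →ₗ[k] V ⊗[k] V}

/-- The differential `D'`. -/
def dPrime (hR : IsHecke q R) : KoszulAlgebra q R →ₗ[k] KoszulAlgebra q R :=
  contr (evBraid hR) (KoszulAlgebra q R) ∘ₗ (derivV hR).lTensor (Dual k V) ∘ₗ derivDual hR

/-! ### Recursions for `D'` under left multiplication by generators -/

section Recursion

theorem derivV_comp_mulConst_gDual (hR : IsHecke q R) (y : KoszulAlgebra q R) :
    derivV hR ∘ₗ mulConst (gDual q R) y = (actDualV hR).flip (derivV hR y) :=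
  LinearMap.ext fun ξ => derivV_gDual_mul hR ξ y

theorem derivV_comp_mulConst_gV (hR : IsHecke q R) (y : KoszulAlgebra q R) :
    derivV hR ∘ₗ mulConst (gV q R) y
      = (TensorProduct.mk k V (KoszulAlgebra q R)).flip (scale hR y)
        + (-1 : k) • (actVV hR).flip (derivV hR y) :=
  LinearMap.ext fun v => (derivV_gV_mul hR v y).trans (by simp [sub_eq_add_neg])

theorem contr_derivV_crossAct_dual (hR : IsHecke q R) (ξ : Dual k V)
    (t : Dual k V ⊗[k] KoszulAlgebra q R) :
    contr (evBraid hR) _ ((derivV hR).lTensor (Dual k V)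
        (crossAct (sharp (sharp R)) (gDual q R) ξ t))
      = gDual q R ξ * contr (evBraid hR) _ ((derivV hR).lTensor (Dual k V) t) := by
  induction t using TensorProduct.induction_on with
  | zero => simp
  | add s t hs ht => simp only [map_add, hs, ht, mul_add]
  | tmul η y =>
    rw [crossAct_tmul, ← LinearMap.comp_apply (LinearMap.lTensor _ _), ← LinearMap.lTensor_comp,
      derivV_comp_mulConst_gDual, contr_lTensor_crossAct _ _ _ _ (contr_evBraid_dual hR),
      LinearMap.lTensor_tmul]

/-- The derivative either extracts `v` itself, in which case the crossing `R♯` cancels `c` in the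
cap and plain evaluation at `v` remains, or it extracts a later factor, in which case `v` is pulled
off the cap with the sign of `derivV_gV_mul`. -/
theorem contr_derivV_crossAct_V (hR : IsHecke q R) (v : V)
    (t : Dual k V ⊗[k] KoszulAlgebra q R) :
    contr (evBraid hR) _ ((derivV hR).lTensor (Dual k V) (crossAct (sharp R) (gV q R) v t))
      = scale hR (dualTensorHom k V _ t v)
        - gV q R v * contr (evBraid hR) _ ((derivV hR).lTensor (Dual k V) t) := by
  induction t using TensorProduct.induction_on with
  | zero => simp
  | add s t hs ht => simp only [map_add, hs, ht, mul_add, LinearMap.add_apply]; abel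
  | tmul η y =>
    have h : ∀ (z : Dual k V ⊗[k] V) (a : KoszulAlgebra q R), contr (evBraid hR) _
        (((TensorProduct.mk k V (KoszulAlgebra q R)).flip a).lTensor (Dual k V) z)
        = evBraid hR z • a := by
      intro z a
      induction z using TensorProduct.induction_on with
      | zero => simp
      | tmul ξ v => simp
      | add s t hs ht => simp only [map_add, hs, ht, add_smul]
    rw [crossAct_tmul, ← LinearMap.comp_apply (LinearMap.lTensor _ _), ← LinearMap.lTensor_comp,
      derivV_comp_mulConst_gV, LinearMap.lTensor_add, LinearMap.lTensor_smul, LinearMap.add_apply,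
      LinearMap.smul_apply, map_add, map_smul, h, evBraid_sharp,
      contr_lTensor_crossAct _ _ _ _ (contr_evBraid_V hR), LinearMap.lTensor_tmul]
    simp [sub_eq_add_neg]

theorem dPrime_gDual_mul (hR : IsHecke q R) (ξ : Dual k V) (x : KoszulAlgebra q R) :
    dPrime hR (gDual q R ξ * x)
      = contr (evBraid hR) _ (ξ ⊗ₜ derivV hR x) + q • (gDual q R ξ * dPrime hR x) := by
  simp only [dPrime, LinearMap.comp_apply, derivDual_gDual_mul, map_add, map_smul,
    contr_derivV_crossAct_dual, LinearMap.lTensor_tmul]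

theorem dPrime_gV_mul (hR : IsHecke q R) (v : V) (x : KoszulAlgebra q R) :
    dPrime hR (gV q R v * x)
      = q⁻¹ • (scale hR (dualTensorHom k V _ (derivDual hR x) v) - gV q R v * dPrime hR x) := by
  simp only [dPrime, LinearMap.comp_apply, derivDual_gV_mul, map_smul, contr_derivV_crossAct_V]

end Recursion

/-! ### The formula for `D'` on words, and uniqueness -/

section Words

theorem scale_prod_gV (hR : IsHecke q R) (v : List V) :
    scale hR (v.map (gV q R)).prod = q ^ (-(v.length : ℤ)) • (v.map (gV q R)).prod := by
  induction v with
  | nil => simp [scale_one]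
  | cons w v ih =>
    have hq := hR.q_ne_zero
    rw [List.map_cons, List.prod_cons, scale_gV_mul, ih, mul_smul_comm, smul_smul,
      List.length_cons, ← zpow_neg_one, ← zpow_add₀ hq]
    congr 2
    push_cast
    ring

theorem dPrime_prod_gV (hR : IsHecke q R) (v : List V) : dPrime hR (v.map (gV q R)).prod = 0 := by
  have h : derivDual hR (v.map (gV q R)).prod = 0 := by
    induction v with
    | nil => simp [derivDual_one]
    | cons w v ih => rw [List.map_cons, List.prod_cons, derivDual_gV_mul, ih, map_zero, smul_zero]
  simp [dPrime, h]

theorem derivV_prod_gV (hR : IsHecke q R) (v : List V) :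
    derivV hR (v.map (gV q R)).prod
      = ∑ j : Fin v.length, ((-1) ^ (j : ℕ) * q ^ ((j : ℤ) + 1 - (v.length : ℤ))) •
          (LinearMap.mulRight k ((v.drop (j + 1)).map (gV q R)).prod).lTensor V
            (moveLeft (braidInvVV hR) (gV q R) (v.take j) (v.get j)) := by
  induction v with
  | nil => simp [derivV_one]
  | cons w v ih =>
    rw [List.map_cons, List.prod_cons, derivV_gV_mul, ih, scale_prod_gV, map_sum,
      sub_eq_add_neg, ← Finset.sum_neg_distrib]
    refine Eq.trans ?_ (Fin.sum_univ_succ (n := v.length) _).symm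
    congr 1
    · simp [moveLeft]
    · refine Finset.sum_congr rfl fun j _ => ?_
      rw [map_smul, crossAct_lTensor_mulRight, ← moveLeft_cons, ← neg_smul]
      congr 1
      simp only [Fin.val_succ, List.length_cons, pow_succ]
      push_cast
      rw [add_sub_add_right_eq_sub]
      ring

theorem derivV_prod_gDual_mul (hR : IsHecke q R) (l : List (Dual k V)) (x : KoszulAlgebra q R) :
    derivV hR ((l.map (gDual q R)).prod * x) = (l.map (actDualV hR)).prod (derivV hR x) := by
  induction l with
  | nil => simp
  | cons ξ l ih =>
    rw [List.map_cons, List.prod_cons, mul_assoc, derivV_gDual_mul, ih, List.map_cons,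
      List.prod_cons, Module.End.mul_apply]

theorem contractMiddle_tmul (hR : IsHecke q R) (a : KoszulAlgebra q R) (ξ : Dual k V)
    (t : V ⊗[k] KoszulAlgebra q R) :
    contractMiddle hR ((a ⊗ₜ ξ) ⊗ₜ t) = a * contr (evBraid hR) _ (ξ ⊗ₜ t) := by
  simp only [contractMiddle, LinearMap.comp_apply, LinearEquiv.coe_coe, TensorProduct.assoc_tmul,
    LinearMap.lTensor_tmul, LinearMap.mul'_apply]
  rfl

theorem contractMiddle_mulRight (hR : IsHecke q R) (s : KoszulAlgebra q R ⊗[k] Dual k V)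
    (t : V ⊗[k] KoszulAlgebra q R) (b : KoszulAlgebra q R) :
    contractMiddle hR (s ⊗ₜ (LinearMap.mulRight k b).lTensor V t)
      = contractMiddle hR (s ⊗ₜ t) * b := by
  induction s using TensorProduct.induction_on with
  | zero => simp
  | add s s' hs hs' => simp only [TensorProduct.add_tmul, map_add, hs, hs', add_mul]
  | tmul a ξ => simp [contractMiddle_tmul, contr_lTensor, mul_assoc]

/-- Moving `ξ` to the right by `c⁻¹` before capping is the same as letting the strands of `l` cross
the other leg of the cap: each of them is pulled across by `contr_evBraid_dual`. This matches the
defining formula of `D'` with the action of `V^∨` in `derivV`. -/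
theorem contractMiddle_moveRight (hR : IsHecke q R) (l : List (Dual k V)) (ξ : Dual k V)
    (t : V ⊗[k] KoszulAlgebra q R) :
    contractMiddle hR (moveRight (braidInvDualDual hR) (gDual q R) l ξ ⊗ₜ t)
      = contr (evBraid hR) _ (ξ ⊗ₜ (l.map (actDualV hR)).prod t) := by
  induction l generalizing ξ with
  | nil => simp [moveRight, contractMiddle_tmul]
  | cons x l ih =>
    set t' := (l.map (actDualV hR)).prod t with ht'
    have h1 : ∀ (η : Dual k V) (s : KoszulAlgebra q R ⊗[k] Dual k V),
        contractMiddle hR ((LinearMap.mul' k (KoszulAlgebra q R)).rTensor (Dual k V)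
          ((TensorProduct.assoc k _ _ _).symm (gDual q R η ⊗ₜ s)) ⊗ₜ t)
        = gDual q R η * contractMiddle hR (s ⊗ₜ t) := by
      intro η s
      induction s using TensorProduct.induction_on with
      | zero => simp
      | add s s' hs hs' =>
        simp only [TensorProduct.tmul_add, TensorProduct.add_tmul, map_add, hs, hs', mul_add]
      | tmul a ξ => simp [contractMiddle_tmul, mul_assoc]
    have h2 : ∀ z : Dual k V ⊗[k] Dual k V,
        contractMiddle hR ((LinearMap.mul' k (KoszulAlgebra q R)).rTensor (Dual k V)
          ((TensorProduct.assoc k _ _ _).symm (TensorProduct.map (gDual q R)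
            (moveRight (braidInvDualDual hR) (gDual q R) l) z)) ⊗ₜ t)
        = contr (evBraid hR) _ (((actDualV hR).flip t').lTensor _ (sharp (sharp R) z)) := by
      intro z
      induction z using TensorProduct.induction_on with
      | zero => simp
      | add s s' hs hs' => simp only [TensorProduct.add_tmul, map_add, hs, hs']
      | tmul η ξ =>
        rw [TensorProduct.map_tmul, h1, ih,
          contr_lTensor_crossAct _ _ _ _ (contr_evBraid_dual hR)]
    -- `h2` is applied to `z = c⁻¹(ξ ⊗ x)`, so that its right-hand side contains `c z = ξ ⊗ x`.
    have h3 := LinearMap.congr_fun (comp_braidInvDualDual hR) (ξ ⊗ₜ x)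
    rw [LinearMap.comp_apply, LinearMap.id_apply] at h3
    refine (h2 (braidInvDualDual hR (ξ ⊗ₜ x))).trans ?_
    rw [h3, LinearMap.lTensor_tmul, LinearMap.flip_apply, List.map_cons, List.prod_cons,
      Module.End.mul_apply]

theorem contr_derivV_words (hR : IsHecke q R) (ξ : Dual k V) (l : List (Dual k V)) (v : List V) :
    contr (evBraid hR) _
        (ξ ⊗ₜ derivV hR ((l.map (gDual q R)).prod * (v.map (gV q R)).prod))
      = ∑ j : Fin v.length, ((-1) ^ (j : ℕ) * q ^ ((j : ℤ) + 1 - (v.length : ℤ))) •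
          dPrimeTerm hR (ξ :: l) v ⟨0, Nat.succ_pos _⟩ j := by
  rw [derivV_prod_gDual_mul, ← contractMiddle_moveRight, derivV_prod_gV, TensorProduct.tmul_sum,
    map_sum]
  refine Finset.sum_congr rfl fun j _ => ?_
  rw [TensorProduct.tmul_smul, map_smul, contractMiddle_mulRight]
  simp [dPrimeTerm]

theorem isDiffDPrime_dPrime (hR : IsHecke q R) : IsDiffDPrime hR (dPrime hR) := by
  intro ξ v
  induction ξ with
  | nil => simp [dPrime_prod_gV]
  | cons ξ l ih =>
    rw [List.map_cons, List.prod_cons, mul_assoc, dPrime_gDual_mul, ih, contr_derivV_words]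
    -- The term `i = 0` extracts the leading `ξ`. The others come from `D'` of the shorter word,
    -- whose factor `q` raises the exponent along with `i`.
    refine Eq.trans ?_ (Fin.sum_univ_succ (n := l.length) _).symm
    congr 1
    · refine Finset.sum_congr rfl fun j _ => ?_
      simp
    · rw [Finset.mul_sum, Finset.smul_sum]
      refine Finset.sum_congr rfl fun i _ => ?_
      rw [Finset.mul_sum, Finset.smul_sum]
      refine Finset.sum_congr rfl fun j _ => ?_
      rw [mul_smul_comm, smul_smul]
      congr 1
      · have hq := hR.q_ne_zero
        rw [mul_left_comm, ← zpow_one_add₀ hq]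
        congr 2
        simp only [Fin.val_succ]
        push_cast
        ring
      · simp [dPrimeTerm, mul_assoc]

theorem span_words (hR : IsHecke q R) (x : KoszulAlgebra q R) :
    x ∈ Submodule.span k {y | ∃ (ξ : List (Dual k V)) (v : List V),
      y = (ξ.map (gDual q R)).prod * (v.map (gV q R)).prod} := by
  set N := Submodule.span k {y | ∃ (ξ : List (Dual k V)) (v : List V),
      y = (ξ.map (gDual q R)).prod * (v.map (gV q R)).prod} with hN
  have hD : ∀ ξ, ∀ y ∈ N, gDual q R ξ * y ∈ N := by
    intro ξ y hy
    induction hy using Submodule.span_induction with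
    | zero => simp
    | add y z _ _ hy hz => rw [mul_add]; exact add_mem hy hz
    | smul c y _ hy => rw [mul_smul_comm]; exact N.smul_mem c hy
    | mem y hy =>
      obtain ⟨l, v, rfl⟩ := hy
      exact Submodule.subset_span ⟨ξ :: l, v, by simp [mul_assoc]⟩
  have hV : ∀ (l : List (Dual k V)) (u : List V) (v : V),
      gV q R v * ((l.map (gDual q R)).prod * (u.map (gV q R)).prod) ∈ N := by
    intro l u
    induction l with
    | nil => exact fun v => Submodule.subset_span ⟨[], v :: u, by simp⟩
    | cons ξ l ih =>
      intro v
      -- The mixed relation, divided by `q`, moves `v` to the right past `ξ`.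
      have h := mulMap_gDual_gV (q := q) (R := R) (v ⊗ₜ ξ)
      rw [mulMap_tmul, eq_comm, ← eq_inv_smul_iff₀ hR.q_ne_zero] at h
      rw [List.map_cons, List.prod_cons, mul_assoc, ← mul_assoc, h, smul_mul_assoc]
      refine N.smul_mem _ ?_
      generalize sharp R (v ⊗ₜ ξ) = z
      induction z using TensorProduct.induction_on with
      | zero => simp
      | add s t hs ht => rw [map_add, add_mul]; exact add_mem hs ht
      | tmul η w => rw [mulMap_tmul, mul_assoc]; exact hD _ _ (ih w)
  induction x using koszul_induction with
  | one => exact Submodule.subset_span ⟨[], [], by simp⟩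
  | gDual_mul ξ x ih => exact hD ξ x ih
  | add x y hx hy => exact add_mem hx hy
  | smul c x hx => exact N.smul_mem c hx
  | gV_mul v x ih =>
    induction ih using Submodule.span_induction with
    | zero => simp
    | add y z _ _ hy hz => rw [mul_add]; exact add_mem hy hz
    | smul c y _ hy => rw [mul_smul_comm]; exact N.smul_mem c hy
    | mem y hy =>
      obtain ⟨l, u, rfl⟩ := hy
      exact hV l u v

theorem IsDiffDPrime.unique (hR : IsHecke q R) {E F : KoszulAlgebra q R →ₗ[k] KoszulAlgebra q R}
    (hE : IsDiffDPrime hR E) (hF : IsDiffDPrime hR F) : E = F := by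
  ext x
  induction span_words hR x using Submodule.span_induction with
  | zero => simp
  | add y z _ _ hy hz => rw [map_add, map_add, hy, hz]
  | smul c y _ hy => rw [map_smul, map_smul, hy]
  | mem y hy =>
    obtain ⟨l, u, rfl⟩ := hy
    rw [hE, hF]

end Words

/-! ### Bidegrees and Euler operators -/

section Components

theorem component_induction {p : ℕ → ℕ → KoszulAlgebra q R → Prop} (one : p 0 0 1)
    (gV_mul : ∀ n m v, ∀ x ∈ component q R n m, p n m x → p (n + 1) m (gV q R v * x))
    (gDual_mul : ∀ n m ξ, ∀ x ∈ component q R n m, p n m x → p n (m + 1) (gDual q R ξ * x))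
    (zero : ∀ n m, p n m 0) (add : ∀ n m x y, p n m x → p n m y → p n m (x + y))
    (smul : ∀ n m (c : k) x, p n m x → p n m (c • x)) {n m : ℕ} {x : KoszulAlgebra q R}
    (hx : x ∈ component q R n m) : p n m x := by
  induction hx using Submodule.span_induction with
  | zero => exact zero n m
  | add x y _ _ hx hy => exact add n m x y hx hy
  | smul c x _ hx => exact smul n m c x hx
  | mem x hx =>
    obtain ⟨w, rfl, rfl, rfl⟩ := hx
    induction w with
    | nil => simpa using one
    | cons a w ih =>
      rcases a with v | ξ
      · simpa [List.countP_cons] using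
          gV_mul _ _ v _ (Submodule.subset_span ⟨w, rfl, rfl, rfl⟩) ih
      · simpa [List.countP_cons] using
          gDual_mul _ _ ξ _ (Submodule.subset_span ⟨w, rfl, rfl, rfl⟩) ih

theorem scale_of_mem_component (hR : IsHecke q R) {n m : ℕ} {x : KoszulAlgebra q R}
    (hx : x ∈ component q R n m) : scale hR x = q ^ (-((n : ℤ) + m)) • x := by
  have hq := hR.q_ne_zero
  refine component_induction (p := fun n m x => scale hR x = q ^ (-((n : ℤ) + m)) • x)
    ?_ ?_ ?_ ?_ ?_ ?_ hx
  · simp [scale_one]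
  · intro n m v x _ ih
    rw [scale_gV_mul, ih, mul_smul_comm, smul_smul, ← zpow_neg_one, ← zpow_add₀ hq]
    congr 2; push_cast; ring
  · intro n m ξ x _ ih
    rw [scale_gDual_mul, ih, mul_smul_comm, smul_smul, ← zpow_neg_one, ← zpow_add₀ hq]
    congr 2; push_cast; ring
  · simp
  · intro n m x y hx hy
    rw [map_add, hx, hy, smul_add]
  · intro n m c x hx
    rw [map_smul, hx, smul_comm]

theorem mulMap_braidInvVV (hR : IsHecke q R) (z : V ⊗[k] V) :
    mulMap (gV q R) (gV q R) (braidInvVV hR z) = -q • mulMap (gV q R) (gV q R) z := by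
  have hq := hR.q_ne_zero
  rw [braidInvVV_apply, map_sub, map_smul, mulMap_gV_gV]
  module

theorem mulMap_braidDualV (hR : IsHecke q R) (z : Dual k V ⊗[k] V) :
    mulMap (gV q R) (gDual q R) (braidDualV hR z) = q⁻¹ • mulMap (gDual q R) (gV q R) z := by
  have h := LinearMap.congr_fun (comp_braidDualV hR) z
  rw [LinearMap.comp_apply, LinearMap.id_apply] at h
  rw [eq_inv_smul_iff₀ hR.q_ne_zero, ← mulMap_gDual_gV, h]

/-- An Euler identity. Multiplying the extracted factor back on the left, past a generator, costs
`-q` for `V` and `q⁻¹` for `V^∨`. With the sign of `derivV` this is the recursion `[n + 1] = q^{-n}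
+ q [n]`. -/
theorem leftMul_derivV (hR : IsHecke q R) {n m : ℕ} {x : KoszulAlgebra q R}
    (hx : x ∈ component q R n m) :
    leftMul (gV q R) (derivV hR x) = (q ^ (-(m : ℤ)) * qInt q n) • x := by
  have hq := hR.q_ne_zero
  refine component_induction (p := fun n m x => leftMul (gV q R) (derivV hR x)
    = (q ^ (-(m : ℤ)) * qInt q n) • x) ?_ ?_ ?_ ?_ ?_ ?_ hx
  · simp [derivV_one, qInt_zero]
  · intro n m v x hx ih
    rw [derivV_gV_mul, map_sub, leftMul_tmul, scale_of_mem_component hR hx,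
      leftMul_crossAct _ _ _ _ (mulMap_braidInvVV hR), ih, mul_smul_comm, mul_smul_comm, smul_smul,
      ← sub_smul, Nat.cast_add_one, qInt_add_one hq, neg_add, zpow_add₀ hq]
    congr 1
    ring
  · intro n m ξ x _ ih
    rw [derivV_gDual_mul, leftMul_crossAct _ _ _ _ (mulMap_braidDualV hR), ih, mul_smul_comm,
      smul_smul, Nat.cast_add_one, neg_add, zpow_add₀ hq, zpow_neg_one]
    congr 1
    ring
  · simp
  · intro n m x y hx hy
    rw [map_add, map_add, hx, hy, smul_add]
  · intro n m c x hx
    rw [map_smul, map_smul, hx, smul_comm]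

/-- Here passing `V` costs nothing (`q⁻¹ · q`) and passing `V^∨` costs `q²`, so the scalar is `1 +
q² + ⋯ + q^{2m-2}`. -/
theorem leftMul_derivDual (hR : IsHecke q R) {n m : ℕ} {x : KoszulAlgebra q R}
    (hx : x ∈ component q R n m) :
    leftMul (gDual q R) (derivDual hR x) = (q ^ ((m : ℤ) - 1) * qInt q m) • x := by
  have hq := hR.q_ne_zero
  refine component_induction (p := fun _ m x => leftMul (gDual q R) (derivDual hR x)
    = (q ^ ((m : ℤ) - 1) * qInt q m) • x) ?_ ?_ ?_ ?_ ?_ ?_ hx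
  · simp [derivDual_one, qInt_zero]
  · intro n m v x hx ih
    rw [derivDual_gV_mul, map_smul, leftMul_crossAct _ _ _ _ mulMap_gDual_gV, ih, mul_smul_comm,
      inv_smul_smul₀ hq]
  · intro n m ξ x _ ih
    have h : q ^ (m : ℤ) * q ^ (-(m : ℤ)) = 1 := by
      rw [← zpow_add₀ hq, add_neg_cancel, zpow_zero]
    have h' : q ^ (m : ℤ) = q * q ^ ((m : ℤ) - 1) := by
      rw [← zpow_one_add₀ hq]; congr 1; ring
    rw [derivDual_gDual_mul, map_add, map_smul, leftMul_crossAct _ _ _ _ mulMap_gDual_gDual, ih,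
      leftMul_tmul, mul_smul_comm, Nat.cast_add_one, qInt_add_one hq, add_sub_cancel_right, mul_add,
      h, h']
    module
  · simp
  · intro n m x y hx hy
    rw [map_add, map_add, hx, hy, smul_add]
  · intro n m c x hx
    rw [map_smul, map_smul, hx, smul_comm]

/-- The bigraded components of `K(V)`, indexed by pairs of integers. -/
def intComponent (q : k) (R : V ⊗[k] V →ₗ[k] V ⊗[k] V) (a b : ℤ) :
    Submodule k (KoszulAlgebra q R) :=
  -- The supremum is empty, hence `⊥`, if `a` or `b` is negative. Degrees can therefore be lowered
  -- without separating the case of degree zero, in agreement with `coboundaries`.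
  ⨆ (n : ℕ) (m : ℕ) (_ : (n : ℤ) = a ∧ (m : ℤ) = b), component q R n m

theorem component_le_intComponent (n m : ℕ) {a b : ℤ} (ha : (n : ℤ) = a) (hb : (m : ℤ) = b) :
    component q R n m ≤ intComponent q R a b :=
  le_iSup_of_le n (le_iSup_of_le m (le_iSup_of_le ⟨ha, hb⟩ le_rfl))

theorem intComponent_le {a b : ℤ} {S : Submodule k (KoszulAlgebra q R)}
    (h : ∀ n m : ℕ, (n : ℤ) = a → (m : ℤ) = b → component q R n m ≤ S) :
    intComponent q R a b ≤ S :=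
  iSup_le fun n => iSup_le fun m => iSup_le fun h' => h n m h'.1 h'.2

theorem gV_mul_mem_component (v : V) {n m : ℕ} {x : KoszulAlgebra q R}
    (hx : x ∈ component q R n m) : gV q R v * x ∈ component q R (n + 1) m := by
  induction hx using Submodule.span_induction with
  | zero => simp
  | add x y _ _ hx hy => rw [mul_add]; exact add_mem hx hy
  | smul c x _ hx => rw [mul_smul_comm]; exact Submodule.smul_mem _ c hx
  | mem x hx =>
    obtain ⟨w, rfl, rfl, rfl⟩ := hx
    exact Submodule.subset_span ⟨Sum.inl v :: w, by simp [List.countP_cons]⟩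

theorem gDual_mul_mem_component (ξ : Dual k V) {n m : ℕ} {x : KoszulAlgebra q R}
    (hx : x ∈ component q R n m) : gDual q R ξ * x ∈ component q R n (m + 1) := by
  induction hx using Submodule.span_induction with
  | zero => simp
  | add x y _ _ hx hy => rw [mul_add]; exact add_mem hx hy
  | smul c x _ hx => rw [mul_smul_comm]; exact Submodule.smul_mem _ c hx
  | mem x hx =>
    obtain ⟨w, rfl, rfl, rfl⟩ := hx
    exact Submodule.subset_span ⟨Sum.inr ξ :: w, by simp [List.countP_cons]⟩

theorem gV_mul_mem_intComponent (v : V) {a b : ℤ} {x : KoszulAlgebra q R}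
    (hx : x ∈ intComponent q R a b) : gV q R v * x ∈ intComponent q R (a + 1) b := by
  suffices h : intComponent q R a b
      ≤ (intComponent q R (a + 1) b).comap (LinearMap.mulLeft k (gV q R v)) from h hx
  refine intComponent_le fun n m hn hm y hy => ?_
  exact component_le_intComponent (n + 1) m (by push_cast; rw [hn]) hm (gV_mul_mem_component v hy)

theorem gDual_mul_mem_intComponent (ξ : Dual k V) {a b : ℤ} {x : KoszulAlgebra q R}
    (hx : x ∈ intComponent q R a b) : gDual q R ξ * x ∈ intComponent q R a (b + 1) := by
  suffices h : intComponent q R a b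
      ≤ (intComponent q R a (b + 1)).comap (LinearMap.mulLeft k (gDual q R ξ)) from h hx
  refine intComponent_le fun n m hn hm y hy => ?_
  exact component_le_intComponent n (m + 1) hn (by push_cast; rw [hm])
    (gDual_mul_mem_component ξ hy)

/-- `Submodule.map₂` along the tensor product expresses that the algebra factor has lost one degree
in `V`. -/
theorem derivV_mem (hR : IsHecke q R) {n m : ℕ} {x : KoszulAlgebra q R}
    (hx : x ∈ component q R n m) :
    derivV hR x ∈ Submodule.map₂ (TensorProduct.mk k V (KoszulAlgebra q R)) ⊤
      (intComponent q R ((n : ℤ) - 1) m) := by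
  refine component_induction (p := fun n m x => derivV hR x ∈ Submodule.map₂
    (TensorProduct.mk k V (KoszulAlgebra q R)) ⊤ (intComponent q R ((n : ℤ) - 1) m))
    ?_ ?_ ?_ ?_ ?_ ?_ hx
  · simp [derivV_one]
  · intro n m v x hx ih
    rw [derivV_gV_mul, scale_of_mem_component hR hx]
    refine sub_mem (Submodule.apply_mem_map₂ _ Submodule.mem_top (Submodule.smul_mem _ _
      (component_le_intComponent n m (by simp) rfl hx))) ?_
    refine crossAct_mem_map₂ _ _ (fun w y hy => ?_) v ih
    have := gV_mul_mem_intComponent w hy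
    rwa [show (n : ℤ) - 1 + 1 = ((n + 1 : ℕ) : ℤ) - 1 by push_cast; ring] at this
  · intro n m ξ x hx ih
    rw [derivV_gDual_mul]
    refine crossAct_mem_map₂ _ _ (fun w y hy => ?_) ξ ih
    exact_mod_cast gDual_mul_mem_intComponent w hy
  · simp
  · intro n m x y hx hy
    rw [map_add]
    exact add_mem hx hy
  · intro n m c x hx
    rw [map_smul]
    exact Submodule.smul_mem _ c hx

theorem derivDual_mem (hR : IsHecke q R) {n m : ℕ} {x : KoszulAlgebra q R}
    (hx : x ∈ component q R n m) :
    derivDual hR x ∈ Submodule.map₂ (TensorProduct.mk k (Dual k V) (KoszulAlgebra q R)) ⊤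
      (intComponent q R n ((m : ℤ) - 1)) := by
  refine component_induction (p := fun n m x => derivDual hR x ∈ Submodule.map₂
    (TensorProduct.mk k (Dual k V) (KoszulAlgebra q R)) ⊤ (intComponent q R n ((m : ℤ) - 1)))
    ?_ ?_ ?_ ?_ ?_ ?_ hx
  · simp [derivDual_one]
  · intro n m v x hx ih
    rw [derivDual_gV_mul]
    refine Submodule.smul_mem _ _ (crossAct_mem_map₂ _ _ (fun w y hy => ?_) v ih)
    exact_mod_cast gV_mul_mem_intComponent w hy
  · intro n m ξ x hx ih
    rw [derivDual_gDual_mul]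
    refine add_mem (Submodule.apply_mem_map₂ _ Submodule.mem_top
      (component_le_intComponent n m rfl (by simp) hx)) ?_
    refine Submodule.smul_mem _ _ (crossAct_mem_map₂ _ _ (fun w y hy => ?_) ξ ih)
    have := gDual_mul_mem_intComponent w hy
    rwa [show (m : ℤ) - 1 + 1 = ((m + 1 : ℕ) : ℤ) - 1 by push_cast; ring] at this
  · simp
  · intro n m x y hx hy
    rw [map_add]
    exact add_mem hx hy
  · intro n m c x hx
    rw [map_smul]
    exact Submodule.smul_mem _ c hx

theorem dPrime_mem (hR : IsHecke q R) {n m : ℕ} {x : KoszulAlgebra q R}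
    (hx : x ∈ component q R n m) :
    dPrime hR x ∈ intComponent q R ((n : ℤ) - 1) ((m : ℤ) - 1) := by
  suffices h : Submodule.map₂ (TensorProduct.mk k (Dual k V) (KoszulAlgebra q R)) ⊤
      (intComponent q R n ((m : ℤ) - 1)) ≤ (intComponent q R ((n : ℤ) - 1) ((m : ℤ) - 1)).comap
        (contr (evBraid hR) (KoszulAlgebra q R) ∘ₗ (derivV hR).lTensor (Dual k V)) from
    h (derivDual_mem hR hx)
  refine Submodule.map₂_le.2 fun ξ _ y hy => ?_
  rw [Submodule.mem_comap, TensorProduct.mk_apply, LinearMap.comp_apply, LinearMap.lTensor_tmul]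
  suffices h : intComponent q R n ((m : ℤ) - 1)
      ≤ (intComponent q R ((n : ℤ) - 1) ((m : ℤ) - 1)).comap
        (contr (evBraid hR) (KoszulAlgebra q R) ∘ₗ TensorProduct.mk k _ _ ξ ∘ₗ derivV hR) from h hy
  refine intComponent_le fun n' m' hn hm y hy => ?_
  have h := derivV_mem hR hy
  rw [hn, hm] at h
  suffices h' : Submodule.map₂ (TensorProduct.mk k V (KoszulAlgebra q R)) ⊤
      (intComponent q R ((n : ℤ) - 1) ((m : ℤ) - 1))
      ≤ (intComponent q R ((n : ℤ) - 1) ((m : ℤ) - 1)).comap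
        (contr (evBraid hR) (KoszulAlgebra q R) ∘ₗ TensorProduct.mk k _ _ ξ) from h' h
  refine Submodule.map₂_le.2 fun v _ z hz => ?_
  simpa using Submodule.smul_mem _ _ hz

theorem diffD_dPrime_mem_coboundaries (hR : IsHecke q R) {n m : ℕ} {x : KoszulAlgebra q R}
    (hx : x ∈ component q R n m) : diffD q R (dPrime hR x) ∈ coboundaries q R n m := by
  suffices h : intComponent q R ((n : ℤ) - 1) ((m : ℤ) - 1)
      ≤ (coboundaries q R n m).comap (diffD q R) from h (dPrime_mem hR hx)
  refine intComponent_le fun n' m' hn hm y hy => ?_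
  obtain rfl : n = n' + 1 := by omega
  obtain rfl : m = m' + 1 := by omega
  exact Submodule.mem_map_of_mem hy

end Components

/-! ### The Laplacian and the vanishing of cohomology -/

section Laplacian

/-- A second-order Leibniz rule: both legs of `z` are contracted with each other, only the `V^∨` leg
with `x`, only the `V` leg with `x`, or neither. In the last case `D'` passes `V^∨` with factor `q`
and `V` with factor `-q⁻¹`, which leaves the sign `-1`. -/
theorem dPrime_mulMap_mul (hR : IsHecke q R) (z : Dual k V ⊗[k] V) (x : KoszulAlgebra q R) :
    dPrime hR (mulMap (gDual q R) (gV q R) z * x)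
      = evBraid hR z • scale hR x
        - contr (evBraid hR) _ (((actVV hR).flip (derivV hR x)).lTensor _ z)
        + leftMul (gDual q R) ((scale hR ∘ₗ dualTensorHom k V _ (derivDual hR x)).lTensor _ z)
        - mulMap (gDual q R) (gV q R) z * dPrime hR x := by
  induction z using TensorProduct.induction_on with
  | zero => simp
  | add s t hs ht =>
    simp only [map_add, add_mul, hs, ht, add_smul]
    abel
  | tmul ξ v =>
    rw [mulMap_tmul, mul_assoc, dPrime_gDual_mul, derivV_gV_mul, dPrime_gV_mul, mul_smul_comm,
      smul_inv_smul₀ hR.q_ne_zero, TensorProduct.tmul_sub, map_sub, contr_tmul, mul_sub, mul_assoc]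
    simp only [LinearMap.lTensor_tmul, LinearMap.flip_apply, leftMul_tmul, LinearMap.comp_apply]
    abel

theorem contr_coevOne_flip (hR : IsHecke q R) (t : V ⊗[k] KoszulAlgebra q R) :
    contr (evBraid hR) _ (((actVV hR).flip t).lTensor _ (coevOne k V))
      = (1 - (q - q⁻¹) * dim8 hR) • leftMul (gV q R) t := by
  induction t using TensorProduct.induction_on with
  | zero => simp
  | add s t hs ht =>
    simp only [map_add, LinearMap.lTensor_add, LinearMap.add_apply, hs, ht, smul_add]
  | tmul w a =>
    rw [contr_lTensor_flip_crossAct, contr_coevOne]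
    simp

theorem leftMul_lTensor_scale (hR : IsHecke q R) (t : Dual k V ⊗[k] KoszulAlgebra q R) :
    leftMul (gDual q R) ((scale hR).lTensor _ t) = q • scale hR (leftMul (gDual q R) t) := by
  induction t using TensorProduct.induction_on with
  | zero => simp
  | add s t hs ht => simp only [map_add, hs, ht, smul_add]
  | tmul ξ a => simp [scale_gDual_mul, smul_smul, mul_inv_cancel₀ hR.q_ne_zero]

theorem laplacian (hR : IsHecke q R) {n m : ℕ} {x : KoszulAlgebra q R}
    (hx : x ∈ component q R n m) :
    (dPrime hR ∘ₗ diffD q R + diffD q R ∘ₗ dPrime hR) x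
      = (q ^ ((n : ℤ) - m) * dim8 hR + qInt q ((m : ℤ) - n)) • x := by
  have hq := hR.q_ne_zero
  have h1 : dPrime hR (diffD q R x) = dim8 hR • scale hR x
      - (1 - (q - q⁻¹) * dim8 hR) • leftMul (gV q R) (derivV hR x)
      + q • scale hR (leftMul (gDual q R) (derivDual hR x)) - diffD q R (dPrime hR x) := by
    rw [← leftMul_lTensor_scale, ← contr_coevOne_flip]
    refine (dPrime_mulMap_mul hR (coevOne k V) x).trans ?_
    rw [LinearMap.lTensor_comp, LinearMap.comp_apply, lTensor_coevOne]
    rfl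
  -- The factors come from moving `scale` past `V^∨`, from the Euler operator of `V^∨`, and from
  -- `scale` in bidegree `(n, m)`.
  have h2 : q * (q ^ ((m : ℤ) - 1) * (q ^ (-((n : ℤ) + m)))) = q ^ (-(n : ℤ)) := by
    rw [← zpow_add₀ hq, ← zpow_one_add₀ hq]
    congr 1; ring
  rw [LinearMap.add_apply, LinearMap.comp_apply, LinearMap.comp_apply, h1, sub_add_cancel,
    leftMul_derivV hR hx, leftMul_derivDual hR hx, map_smul, scale_of_mem_component hR hx,
    ← laplacian_scalar hq, ← h2]
  module

theorem dim8_of_nontrivial_ber (hR : IsHecke q R) {n m : ℕ} (h : Nontrivial (Ber q R n m)) :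
    dim8 hR = q ^ ((m : ℤ) - n) * qInt q ((n : ℤ) - m) := by
  have hq := hR.q_ne_zero
  have h0 : q ^ ((n : ℤ) - m) * dim8 hR + qInt q ((m : ℤ) - n) = 0 := by
    by_contra hne
    rw [Submodule.Quotient.nontrivial_iff] at h
    refine h (Submodule.eq_top_iff'.2 fun ⟨x, hx⟩ => ?_)
    change x ∈ coboundaries q R n m
    -- On a cocycle `L x = D D' x`, so dividing by the non-zero scalar exhibits `x` as a coboundary.
    have hL := laplacian hR hx.1
    rw [LinearMap.add_apply, LinearMap.comp_apply, LinearMap.mem_ker.1 hx.2, map_zero, zero_add,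
      LinearMap.comp_apply] at hL
    rw [← inv_smul_smul₀ hne x, ← hL]
    exact Submodule.smul_mem _ _ (diffD_dPrime_mem_coboundaries hR hx.1)
  have h1 : qInt q ((n : ℤ) - m) = q ^ ((n : ℤ) - m) * dim8 hR := by
    have h2 := qInt_neg hq ((m : ℤ) - n)
    rw [neg_sub] at h2
    rw [h2]
    linear_combination -h0
  rw [h1, ← mul_assoc, ← zpow_add₀ hq]
  simp

end Laplacian

end HeckeKoszul

end

theorem mainTheorem2 {k : Type*} [Field k] [CharZero k] {V : Type*} [AddCommGroup V]
    [Module k V] [FiniteDimensional k V] (q : k) (R : V ⊗[k] V →ₗ[k] V ⊗[k] V)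
    (hR : HeckeKoszul.IsHecke q R) :
    ∃ D' : HeckeKoszul.KoszulAlgebra q R →ₗ[k] HeckeKoszul.KoszulAlgebra q R,
      (HeckeKoszul.IsDiffDPrime hR D' ∧ ∀ E, HeckeKoszul.IsDiffDPrime hR E → E = D') ∧
      (∀ (n m : ℕ), ∀ x ∈ HeckeKoszul.component q R n m,
        (D' ∘ₗ HeckeKoszul.diffD q R + HeckeKoszul.diffD q R ∘ₗ D') x =
          (q ^ ((n : ℤ) - m) * HeckeKoszul.dim8 hR + HeckeKoszul.qInt q ((m : ℤ) - n)) • x) ∧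
      (∀ (n m : ℕ), Nontrivial (HeckeKoszul.Ber q R n m) →
        HeckeKoszul.dim8 hR = q ^ ((m : ℤ) - n) * HeckeKoszul.qInt q ((n : ℤ) - m)) :=
  ⟨HeckeKoszul.dPrime hR,
    ⟨HeckeKoszul.isDiffDPrime_dPrime hR,
      fun _ hE => hE.unique hR (HeckeKoszul.isDiffDPrime_dPrime hR)⟩,
    fun _ _ _ hx => HeckeKoszul.laplacian hR hx,
    fun _ _ h => HeckeKoszul.dim8_of_nontrivial_ber hR h⟩
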